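/- Let $(Z,\mathfrak Z,\nu)$ be a $\sigma$-finite measure space and let $\eta$ be a Poisson point process on $Z$ with intensity $\nu$, defined on a probability space $(\Omega,\mathfrak O,\mathbb P)$. Random variables $F$ measurable with respect to $\eta$ are written $F=f(\eta)$ with $f$ measurable, and $D_zF=f(\eta+\delta_z)-f(\eta)$ for $z\in Z$. Let $\operatorname{dom}D$ be the set of such real-valued $F\in L^2(\mathbb P)$ with $DF\in L^2(\mathbb P\otimes\nu)$. Let $\delta$ be the adjoint of $D$: its domain $\operatorname{dom}\delta$ consists of the random functions $u\in L^2(\mathbb P\otimes\nu)$, depending on $\omega$ through $\eta$, for which there is $c>0$ with $|\mathbb E\int_Z u(z)\,D_zG\,\nu(\mathrm dz)|\le c\,(\mathbb E G^2)^{1/2}$ for all $G\in\operatorname{dom}D$, and $\delta u\in L^2(\mathbb P)$ is the $\eta$-measurable random variable characterised by $\mathbb E[G\,\delta u]=\mathbb E\int_Z u(z)\,D_zG\,\nu(\mathrm dz)$ for all $G\in\operatorname{dom}D$. For $S$ measurable with respect to $\eta$, write $S\in\mathbf{cov}$ if $S\in\operatorname{dom}D$ and $S^2\in\operatorname{dom}D$,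 and let $\mathbf N(0,S^2)$ denote the law of $SN$, where $N$ is a standard Gaussian variable independent of $\eta$. The Monge–Kantorovich distance of two laws on $\mathbb R$ is $d_1(X,Y)=\inf\{\mathbb E|\tilde X-\tilde Y| : \tilde X\sim X,\ \tilde Y\sim Y\}$. Write $\nu(h)=\int_Z h\,\mathrm d\nu$. **Theorem.** Let $F\in\operatorname{dom}D$ be real-valued with $F=\delta u$ for some $u\in\operatorname{dom}\delta$, and let $S\in\mathbf{cov}$ be real-valued. Set $$\Delta_1=\Bigl(\frac2\pi\Bigr)^{1/2}\bigl(2+\mathbb E|S|\bigr)+\mathbb E|F|,$$ $$\Delta_2=\frac14\Bigl(\frac2\pi\Bigr)^{1/2}\mathbb E\bigl|\nu(u\,DF)-S^2\bigr|+2^{1/2}\Bigl(\frac13\,\mathbb E\bigl|S\,\nu(u\,DS)\bigr|+\frac16\,\mathbb E\,\nu\bigl(|u|\,(|DF|^2+|DS|^2)\bigr)\Bigr)\in[0,\infty].$$ Then $$d_1\bigl(F,\mathbf N(0,S^2)\bigr)\le\max\Bigl(\bigl(2^{1/3}+2^{-2/3}\bigr)\,\Delta_1^{2/3}\,\Delta_2^{1/3},\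 \Delta_1\Delta_2\Bigr).$$ -/

import Mathlib

open MeasureTheory ProbabilityTheory
open scoped ENNReal

noncomputable section

/-- A measure is a countable sum of `ℕ`-valued measures. -/
def IsCountingSum {Z : Type*} [MeasurableSpace Z] (m : Measure Z) : Prop :=
  ∃ s : ℕ → Measure Z,
    (∀ i : ℕ, ∀ B : Set Z, MeasurableSet B → ∃ k : ℕ, s i B = (k : ℝ≥0∞)) ∧
      m = Measure.sum s

/-- The space of configurations on `Z`: all countable sums of `ℕ`-valued measures. -/
def Config (Z : Type*) [MeasurableSpace Z] : Type _ := {m : Measure Z // IsCountingSum m}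

/-- The `σ`-algebra on configurations generated by the evaluations `ξ ↦ ξ B`, `B` measurable
(the one that Mathlib puts on measures, restricted to configurations). -/
instance Config.instMeasurableSpace (Z : Type*) [MeasurableSpace Z] : MeasurableSpace (Config Z) :=
  MeasurableSpace.comap Subtype.val Measure.instMeasurableSpace

lemma IsCountingSum.add_dirac {Z : Type*} [MeasurableSpace Z] {m : Measure Z}
    (hm : IsCountingSum m) (z : Z) : IsCountingSum (m + Measure.dirac z) := by
  obtain ⟨s, hs, rfl⟩ := hm
  refine ⟨fun i => Nat.casesOn i (Measure.dirac z) s, ?_, ?_⟩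
  · rintro (_ | i) B hB
    · by_cases h : z ∈ B
      · exact ⟨1, by simp [Measure.dirac_apply' z hB, h]⟩
      · exact ⟨0, by simp [Measure.dirac_apply' z hB, h]⟩
    · exact hs i B hB
  · ext B hB
    rw [Measure.add_apply, Measure.sum_apply _ hB, Measure.sum_apply _ hB, add_comm]
    exact (tsum_eq_zero_add' (f := fun i => (Nat.casesOn i (Measure.dirac z) s : Measure Z) B)
      ENNReal.summable).symm

/-- The configuration `ξ + δ_z`. -/
def Config.addPoint {Z : Type*} [MeasurableSpace Z] (ξ : Config Z) (z : Z) : Config Z :=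
  ⟨ξ.1 + Measure.dirac z, ξ.2.add_dirac z⟩

/-- `η` is a Poisson point process with intensity `ν`, on the probability space `(Ω, P)`. -/
structure IsPoissonProcess {Ω Z : Type*} [MeasurableSpace Ω] [MeasurableSpace Z]
    (P : Measure Ω) (ν : Measure Z) (η : Ω → Config Z) : Prop where
  measurable : Measurable η
  indep : ∀ (n : ℕ) (B : Fin n → Set Z), (∀ i, MeasurableSet (B i)) →
    Pairwise (Function.onFun Disjoint B) →
      iIndepFun (fun (i : Fin n) (ω : Ω) => (η ω).1 (B i)) P
  law : ∀ B : Set Z, MeasurableSet B → ν B < ∞ →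
    P.map (fun ω => (η ω).1 B) =
      (poissonMeasure (ν B).toNNReal).map (fun k : ℕ => (k : ℝ≥0∞))

/-- The add operator, on a representative `f` of the random variable `F = f(η)`:
`D_z f (ξ) = f(ξ + δ_z) - f(ξ)`, so that `D_z F = (D_z f)(η)`. -/
def addOp {Z : Type*} [MeasurableSpace Z] (f : Config Z → ℝ) (ξ : Config Z) (z : Z) : ℝ :=
  f (ξ.addPoint z) - f ξ

/-- `F = f(η)` belongs to `dom D`: it is square integrable, and `DF` is square integrable with
respect to `P ⊗ ν`. -/
structure InDomD {Ω Z : Type*} [MeasurableSpace Ω] [MeasurableSpace Z]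
    (P : Measure Ω) (ν : Measure Z) (η : Ω → Config Z) (f : Config Z → ℝ) : Prop where
  measurable : Measurable f
  memLp : MemLp (fun ω => f (η ω)) 2 P
  memLp_addOp : MemLp (fun p : Ω × Z => addOp f (η p.1) p.2) 2 (P.prod ν)

/-- The random function `(ω, z) ↦ u(η(ω), z)` belongs to `L²(P ⊗ ν)`. -/
structure InL2Field {Ω Z : Type*} [MeasurableSpace Ω] [MeasurableSpace Z]
    (P : Measure Ω) (ν : Measure Z) (η : Ω → Config Z) (u : Config Z → Z → ℝ) : Prop where
  measurable : Measurable (fun p : Config Z × Z => u p.1 p.2)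
  memLp : MemLp (fun p : Ω × Z => u (η p.1) p.2) 2 (P.prod ν)

/-- `u` belongs to the domain of the divergence `δ`, the adjoint of `D`. -/
structure InDomDelta {Ω Z : Type*} [MeasurableSpace Ω] [MeasurableSpace Z]
    (P : Measure Ω) (ν : Measure Z) (η : Ω → Config Z) (u : Config Z → Z → ℝ) : Prop where
  inL2 : InL2Field P ν η u
  bound : ∃ c : ℝ, 0 < c ∧ ∀ g : Config Z → ℝ, InDomD P ν η g →
    |∫ ω, ∫ z, addOp g (η ω) z * u (η ω) z ∂ν ∂P| ≤ c * Real.sqrt (∫ ω, g (η ω) ^ 2 ∂P)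

/-- `F = f(η)` is the divergence `δu`: it is the square integrable random variable
characterised by `E[G F] = E ∫ u(z) D_z G ν(dz)` for all `G = g(η)` in `dom D`. -/
structure IsDivergence {Ω Z : Type*} [MeasurableSpace Ω] [MeasurableSpace Z]
    (P : Measure Ω) (ν : Measure Z) (η : Ω → Config Z) (u : Config Z → Z → ℝ)
    (f : Config Z → ℝ) : Prop where
  measurable : Measurable f
  memLp : MemLp (fun ω => f (η ω)) 2 P
  duality : ∀ g : Config Z → ℝ, InDomD P ν η g →
    ∫ ω, g (η ω) * f (η ω) ∂P = ∫ ω, ∫ z, u (η ω) z * addOp g (η ω) z ∂ν ∂P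

/-- The univariate class `cov`: `S` and `S²` belong to `dom D`. -/
def InCov {Ω Z : Type*} [MeasurableSpace Ω] [MeasurableSpace Z]
    (P : Measure Ω) (ν : Measure Z) (η : Ω → Config Z) (s : Config Z → ℝ) : Prop :=
  InDomD P ν η s ∧ InDomD P ν η (fun ξ => s ξ ^ 2)

/-- The Monge-Kantorovich distance of two laws on `ℝ`: the infimum of `E|X - Y|` over all
couplings, with values in `[0, ∞]`. -/
def mongeKantorovich (μ₁ μ₂ : Measure ℝ) : ℝ≥0∞ :=
  ⨅ (π : Measure (ℝ × ℝ)) (_ : π.map Prod.fst = μ₁ ∧ π.map Prod.snd = μ₂),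
    ∫⁻ p, ‖p.1 - p.2‖ₑ ∂π

/-- The Gaussian mixture `N(0, S²)`: the law of `S N`, where `N` is standard Gaussian and
independent of everything on `Ω`. -/
def gaussianMixture {Ω : Type*} [MeasurableSpace Ω] (P : Measure Ω) (S : Ω → ℝ) : Measure ℝ :=
  (P.prod (gaussianReal 0 1)).map (fun p : Ω × ℝ => S p.1 * p.2)

/-- `Δ₁ = (2/π)^{1/2} (2 + E|S|) + E|F|`. -/
def delta1 {Ω Z : Type*} [MeasurableSpace Ω] [MeasurableSpace Z]
    (P : Measure Ω) (η : Ω → Config Z) (f s : Config Z → ℝ) : ℝ≥0∞ :=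
  ENNReal.ofReal (Real.sqrt (2 / Real.pi)) * (2 + ∫⁻ ω, ‖s (η ω)‖ₑ ∂P) + ∫⁻ ω, ‖f (η ω)‖ₑ ∂P

/-- `Δ₂ = (1/4) (2/π)^{1/2} E|ν(u DF) - S²|
  + 2^{1/2} ((1/3) E|S ν(u DS)| + (1/6) E ν(|u| (|DF|² + |DS|²)))`, with values in `[0, ∞]`. -/
def delta2 {Ω Z : Type*} [MeasurableSpace Ω] [MeasurableSpace Z]
    (P : Measure Ω) (ν : Measure Z) (η : Ω → Config Z) (u : Config Z → Z → ℝ)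
    (f s : Config Z → ℝ) : ℝ≥0∞ :=
  ENNReal.ofReal (1 / 4 * Real.sqrt (2 / Real.pi)) *
      ∫⁻ ω, ‖(∫ z, u (η ω) z * addOp f (η ω) z ∂ν) - s (η ω) ^ 2‖ₑ ∂P +
    ENNReal.ofReal (Real.sqrt 2) *
      (ENNReal.ofReal (1 / 3) *
          ∫⁻ ω, ‖s (η ω) * ∫ z, u (η ω) z * addOp s (η ω) z ∂ν‖ₑ ∂P +
        ENNReal.ofReal (1 / 6) *
          ∫⁻ ω, ∫⁻ z, ‖u (η ω) z‖ₑ *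
            (‖addOp f (η ω) z‖ₑ ^ 2 + ‖addOp s (η ω) z‖ₑ ^ 2) ∂ν ∂P)

end

/-! By Kantorovich duality on the line it suffices to bound `E φ(SN) - E φ(F)` for every
`1`-Lipschitz `φ`. The quantile coupling realises the dual supremum explicitly
(`mongeKantorovich_le_of_lipschitz`).

Each `φ` is replaced by its convolution `f` with a triangular kernel of width `τ`. This costs `τ/3`
on each of the two expectations, and gives `|f'| ≤ 1`, `|f''| ≤ 2/τ` and a `4/τ²`-Lipschitz `f''`
(`isSmoothTest_triangleSmooth`).

For such `f`, rotate from `SN` to `F` along `W = sin θ F + cos θ N S` and differentiate `E f(W)`.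
The duality between `D` and `δ` expands `E f'(W) F` to second order. Gaussian integration by parts
turns `E f'(W) N S` into `cos θ E f''(W) S²`, which is compared with `sin θ cos θ E f''(W) ν(u DF)`;
this leaves the discrepancy `ν(u DF) - S²`. The remaining first order term, `N ν(u DS)` tested
against `f''(W)`, is controlled by the Lipschitz constant of `f''` because `N` is centred. The
Taylor remainder gives `|u| (|DF|² + |DS|²)`. Integration over a quarter turn is
`IsDualPair.integral_mixture_sub_integral_le`.

The outcome, for all `τ > 0`, is `d₁ ≤ 2τ/3 + A/τ + 4√2 X/τ²`, where `A = E|ν(u DF) - S²|` and `√2 X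
= 2 (B/3 + C/6)`, with `B` and `C` the other two expectations in `Δ₂`. There is also the crude bound
`d₁ ≤ E|F| + E|S|`. Choosing `τ` proportional to `(Δ₂/Δ₁)^{1/3}` gives the first member of the
maximum: either the crude bound already suffices, or its failure forces `τ` to be small enough for
the optimisation to close (`smoothing_bound_le`). The second member of the maximum is never needed.
-/

/-! ### Quantile coupling and Kantorovich duality on the real line -/

/-- The lower quantile function of a measure on `ℝ`. -/
noncomputable def lowerQuantile (μ : Measure ℝ) (u : ℝ) : ℝ := sInf {t | u ≤ cdf μ t}

/-- Right continuity of the distribution function makes the infimum attained. The limits of the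
distribution function at `±∞` make the defining set nonempty and bounded below when `0 < u < 1`. -/
lemma lowerQuantile_le_iff (μ : Measure ℝ) {u : ℝ} (hu : u ∈ Set.Ioo (0 : ℝ) 1) (t : ℝ) :
    lowerQuantile μ u ≤ t ↔ u ≤ cdf μ t := by
  have hne : {t | u ≤ cdf μ t}.Nonempty := by
    obtain ⟨t, ht⟩ := ((tendsto_cdf_atTop μ).eventually (lt_mem_nhds hu.2)).exists
    exact ⟨t, ht.le⟩
  have hbdd : BddBelow {t | u ≤ cdf μ t} := by
    obtain ⟨b, hb⟩ := ((tendsto_cdf_atBot μ).eventually (gt_mem_nhds hu.1)).exists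
    refine ⟨b, fun t ht => ?_⟩
    by_contra! h
    exact absurd (ht.trans (monotone_cdf μ h.le)) (not_le.2 hb)
  constructor
  · intro h
    have hq : u ≤ cdf μ (lowerQuantile μ u) := by
      rw [← StieltjesFunction.iInf_Ioi_eq (cdf μ) (lowerQuantile μ u)]
      have : Nonempty (Set.Ioi (lowerQuantile μ u)) := Set.nonempty_Ioi_subtype
      refine le_ciInf fun r => ?_
      obtain ⟨s, hs, hsr⟩ := exists_lt_of_csInf_lt hne r.2
      exact le_trans hs (monotone_cdf μ hsr.le)
    exact hq.trans (monotone_cdf μ h)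
  · intro h
    exact csInf_le hbdd h

lemma aemeasurable_lowerQuantile (μ : Measure ℝ) :
    AEMeasurable (lowerQuantile μ) (volume.restrict (Set.Ioo (0 : ℝ) 1)) := by
  refine aemeasurable_restrict_of_monotoneOn measurableSet_Ioo fun a ha b hb hab => ?_
  rw [lowerQuantile_le_iff μ ha]
  exact hab.trans ((lowerQuantile_le_iff μ hb _).1 le_rfl)

lemma map_lowerQuantile (μ : Measure ℝ) [IsProbabilityMeasure μ] :
    (volume.restrict (Set.Ioo (0 : ℝ) 1)).map (lowerQuantile μ) = μ := by
  have hfin : IsFiniteMeasure ((volume.restrict (Set.Ioo (0 : ℝ) 1)).map (lowerQuantile μ)) :=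
    inferInstance
  refine Measure.ext_of_Iic _ _ fun t => ?_
  rw [Measure.map_apply_of_aemeasurable (aemeasurable_lowerQuantile μ) measurableSet_Iic,
    ← ofReal_cdf, Measure.restrict_apply' measurableSet_Ioo]
  have h1 : lowerQuantile μ ⁻¹' Set.Iic t ∩ Set.Ioo 0 1 = Set.Iic (cdf μ t) ∩ Set.Ioo 0 1 := by
    ext u
    simp only [Set.mem_inter_iff, Set.mem_preimage, Set.mem_Iic, and_congr_left_iff]
    exact fun hu => lowerQuantile_le_iff μ hu t
  rw [h1]
  -- The interval is squeezed between an open and a half-open one because `cdf μ t` may equal `1`.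
  refine le_antisymm ?_ ?_
  · calc volume (Set.Iic (cdf μ t) ∩ Set.Ioo 0 1) ≤ volume (Set.Ioc 0 (cdf μ t)) :=
          measure_mono fun u hu => ⟨hu.2.1, hu.1⟩
      _ = ENNReal.ofReal (cdf μ t) := by simp
  · calc ENNReal.ofReal (cdf μ t) = volume (Set.Ioo 0 (cdf μ t)) := by simp
      _ ≤ volume (Set.Iic (cdf μ t) ∩ Set.Ioo 0 1) := measure_mono fun u hu =>
          ⟨hu.2.le, hu.1, hu.2.trans_le (cdf_le_one μ t)⟩

/-- A `1`-Lipschitz function which is optimal in the dual problem for the transport of `ν`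
to `μ`. -/
noncomputable def kantorovichPotential (μ ν : Measure ℝ) (x : ℝ) : ℝ :=
  ∫ t in (0 : ℝ)..x, if cdf ν t < cdf μ t then (1 : ℝ) else -1

lemma measurable_kantorovichSlope (μ ν : Measure ℝ) :
    Measurable fun t => if cdf ν t < cdf μ t then (1 : ℝ) else -1 :=
  Measurable.ite (measurableSet_lt (monotone_cdf ν).measurable (monotone_cdf μ).measurable)
    measurable_const measurable_const

lemma intervalIntegrable_kantorovichSlope (μ ν : Measure ℝ) (a b : ℝ) :
    IntervalIntegrable (fun t => if cdf ν t < cdf μ t then (1 : ℝ) else -1) volume a b := by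
  refine (intervalIntegrable_const (c := (1 : ℝ))).mono_fun
    (measurable_kantorovichSlope μ ν).aestronglyMeasurable (Filter.Eventually.of_forall fun t => ?_)
  dsimp only
  split_ifs <;> simp

lemma kantorovichPotential_sub (μ ν : Measure ℝ) (x y : ℝ) :
    kantorovichPotential μ ν y - kantorovichPotential μ ν x =
      ∫ t in x..y, if cdf ν t < cdf μ t then (1 : ℝ) else -1 :=
  intervalIntegral.integral_interval_sub_left (intervalIntegrable_kantorovichSlope μ ν _ _)
    (intervalIntegrable_kantorovichSlope μ ν _ _)

lemma lipschitzWith_kantorovichPotential (μ ν : Measure ℝ) :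
    LipschitzWith 1 (kantorovichPotential μ ν) := by
  refine LipschitzWith.of_dist_le_mul fun y x => ?_
  rw [Real.dist_eq, Real.dist_eq, kantorovichPotential_sub, ← Real.norm_eq_abs]
  refine intervalIntegral.norm_integral_le_of_norm_le_const fun t _ => ?_
  split_ifs <;> simp

/-- For `t` strictly between the two quantiles, the level `u` separates `cdf μ t` from `cdf ν t`.
The slope is therefore constant there, with the sign that makes the Lipschitz inequality an
equality. -/
lemma kantorovichPotential_lowerQuantile_sub (μ ν : Measure ℝ) {u : ℝ}
    (hu : u ∈ Set.Ioo (0 : ℝ) 1) :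
    kantorovichPotential μ ν (lowerQuantile ν u) - kantorovichPotential μ ν (lowerQuantile μ u) =
      |lowerQuantile μ u - lowerQuantile ν u| := by
  rw [kantorovichPotential_sub]
  rcases le_total (lowerQuantile μ u) (lowerQuantile ν u) with h | h
  · rw [intervalIntegral.integral_congr_Ioo_of_le h (g := fun _ => (1 : ℝ))]
    · rw [abs_of_nonpos (by linarith)]; simp
    · intro t ht
      have h1 := (lowerQuantile_le_iff μ hu t).1 ht.1.le
      have h2 := (not_congr (lowerQuantile_le_iff ν hu t)).1 (not_le.2 ht.2)
      exact if_pos ((not_le.1 h2).trans_le h1)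
  · rw [intervalIntegral.integral_symm,
      intervalIntegral.integral_congr_Ioo_of_le h (g := fun _ => (-1 : ℝ))]
    · rw [abs_of_nonneg (by linarith)]; simp
    · intro t ht
      have h1 := (lowerQuantile_le_iff ν hu t).1 ht.1.le
      have h2 := (not_congr (lowerQuantile_le_iff μ hu t)).1 (not_le.2 ht.2)
      exact if_neg (not_lt.2 ((not_le.1 h2).le.trans h1))

lemma LipschitzWith.integrable_comp_real {Ω : Type*} [MeasurableSpace Ω] {P : Measure Ω}
    [IsFiniteMeasure P] {K : NNReal} {φ : ℝ → ℝ} (hφ : LipschitzWith K φ) {X : Ω → ℝ}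
    (hX : Integrable X P) : Integrable (fun ω => φ (X ω)) P := by
  refine ((hX.norm.const_mul (K : ℝ)).add (integrable_const ‖φ 0‖)).mono'
    (hφ.continuous.comp_aestronglyMeasurable hX.1) (Filter.Eventually.of_forall fun ω => ?_)
  have h := hφ.dist_le_mul (X ω) 0
  rw [dist_eq_norm, dist_eq_norm, sub_zero] at h
  calc ‖φ (X ω)‖ = ‖(φ (X ω) - φ 0) + φ 0‖ := by simp
    _ ≤ ‖φ (X ω) - φ 0‖ + ‖φ 0‖ := norm_add_le _ _
    _ ≤ _ := by simpa using h

/-- Kantorovich duality on the real line: the transport distance is bounded by the supremum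
over `1`-Lipschitz functions. -/
theorem mongeKantorovich_le_of_lipschitz {μ ν : Measure ℝ} [IsProbabilityMeasure μ]
    [IsProbabilityMeasure ν] (hμ : Integrable (fun x => x) μ) (hν : Integrable (fun x => x) ν)
    {c : ℝ} (h : ∀ φ : ℝ → ℝ, LipschitzWith 1 φ → ∫ x, φ x ∂ν - ∫ x, φ x ∂μ ≤ c) :
    mongeKantorovich μ ν ≤ ENNReal.ofReal c := by
  let U : Measure ℝ := volume.restrict (Set.Ioo (0 : ℝ) 1)
  have hqm : AEMeasurable _ U := aemeasurable_lowerQuantile μ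
  have hqn : AEMeasurable _ U := aemeasurable_lowerQuantile ν
  have hφ := lipschitzWith_kantorovichPotential μ ν
  have him : Integrable (fun u => kantorovichPotential μ ν (lowerQuantile μ u)) U := by
    have := hφ.integrable_comp_real hμ
    refine (integrable_map_measure (by rw [map_lowerQuantile]; exact this.1) hqm).1 ?_
    rwa [map_lowerQuantile]
  have hin : Integrable (fun u => kantorovichPotential μ ν (lowerQuantile ν u)) U := by
    have := hφ.integrable_comp_real hν
    refine (integrable_map_measure (by rw [map_lowerQuantile]; exact this.1) hqn).1 ?_
    rwa [map_lowerQuantile]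
  -- The competitor is the monotone coupling: both quantile functions evaluated at one uniform
  -- variable.
  refine le_trans
    (iInf₂_le (U.map fun u => (lowerQuantile μ u, lowerQuantile ν u)) (And.intro ?_ ?_)) ?_
  · rw [AEMeasurable.map_map_of_aemeasurable measurable_fst.aemeasurable (hqm.prodMk hqn)]
    exact map_lowerQuantile μ
  · rw [AEMeasurable.map_map_of_aemeasurable measurable_snd.aemeasurable (hqm.prodMk hqn)]
    exact map_lowerQuantile ν
  · rw [lintegral_map' (by fun_prop) (hqm.prodMk hqn)]
    have hae : ∀ᵐ u ∂U, kantorovichPotential μ ν (lowerQuantile ν u) -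
        kantorovichPotential μ ν (lowerQuantile μ u) = |lowerQuantile μ u - lowerQuantile ν u| := by
      filter_upwards [ae_restrict_mem measurableSet_Ioo] with u hu
      exact kantorovichPotential_lowerQuantile_sub μ ν hu
    calc ∫⁻ u, ‖lowerQuantile μ u - lowerQuantile ν u‖ₑ ∂U
        = ∫⁻ u, ENNReal.ofReal (kantorovichPotential μ ν (lowerQuantile ν u) -
            kantorovichPotential μ ν (lowerQuantile μ u)) ∂U := by
          refine lintegral_congr_ae (hae.mono fun u hu => ?_)
          simp only [hu, Real.enorm_eq_ofReal_abs]
      _ = ENNReal.ofReal (∫ u, (kantorovichPotential μ ν (lowerQuantile ν u) -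
            kantorovichPotential μ ν (lowerQuantile μ u)) ∂U) := by
          refine (ofReal_integral_eq_lintegral_ofReal (hin.sub him) ?_).symm
          exact hae.mono fun u hu => by simp only [Pi.zero_apply, Pi.sub_apply]; rw [hu]; positivity
      _ ≤ ENNReal.ofReal c := by
          refine ENNReal.ofReal_le_ofReal ?_
          rw [integral_sub hin him]
          have e1 := integral_map hqm (μ := U) (f := kantorovichPotential μ ν)
            hφ.continuous.aestronglyMeasurable
          have e2 := integral_map hqn (μ := U) (f := kantorovichPotential μ ν)
            hφ.continuous.aestronglyMeasurable
          rw [map_lowerQuantile] at e1 e2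
          rw [← e1, ← e2]
          exact h _ hφ

/-! ### Smoothing of Lipschitz functions by a triangular kernel -/

/-- The first antiderivative of `φ`. -/
noncomputable def primitive (φ : ℝ → ℝ) (x : ℝ) : ℝ := ∫ t in (0 : ℝ)..x, φ t

lemma hasDerivAt_primitive {φ : ℝ → ℝ} (hφ : Continuous φ) (x : ℝ) :
    HasDerivAt (primitive φ) (φ x) x :=
  intervalIntegral.integral_hasDerivAt_right (hφ.intervalIntegrable _ _)
    (hφ.stronglyMeasurableAtFilter _ _) hφ.continuousAt

lemma continuous_primitive {φ : ℝ → ℝ} (hφ : Continuous φ) : Continuous (primitive φ) :=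
  continuous_iff_continuousAt.2 fun x => (hasDerivAt_primitive hφ x).continuousAt

/-- The symmetric second difference quotient of `φ` with step `τ`. -/
noncomputable def secondDiff (τ : ℝ) (φ : ℝ → ℝ) (x : ℝ) : ℝ :=
  (φ (x + τ) - 2 * φ x + φ (x - τ)) / τ ^ 2

lemma HasDerivAt.secondDiff {φ φ' : ℝ → ℝ} (h : ∀ x, HasDerivAt φ (φ' x) x) (τ x : ℝ) :
    HasDerivAt (secondDiff τ φ) (secondDiff τ φ' x) x := by
  have h1 := (h (x + τ)).comp_add_const x τ
  have h2 := (h (x - τ)).comp_sub_const x τ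
  exact ((h1.sub ((h x).const_mul 2)).add h2).div_const _

/-- The convolution of `φ` with the triangular probability density supported by `[-τ, τ]`. -/
noncomputable def triangleSmooth (τ : ℝ) (φ : ℝ → ℝ) : ℝ → ℝ :=
  secondDiff τ (primitive (primitive φ))

lemma hasDerivAt_triangleSmooth {φ : ℝ → ℝ} (hφ : Continuous φ) (τ x : ℝ) :
    HasDerivAt (triangleSmooth τ φ) (secondDiff τ (primitive φ) x) x :=
  HasDerivAt.secondDiff (hasDerivAt_primitive (continuous_primitive hφ)) τ x

lemma hasDerivAt_secondDiff_primitive {φ : ℝ → ℝ} (hφ : Continuous φ) (τ x : ℝ) :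
    HasDerivAt (secondDiff τ (primitive φ)) (secondDiff τ φ x) x :=
  HasDerivAt.secondDiff (hasDerivAt_primitive hφ) τ x

lemma LipschitzWith.abs_sub_le_real {φ : ℝ → ℝ} (hφ : LipschitzWith 1 φ) (x y : ℝ) :
    |φ x - φ y| ≤ |x - y| := by
  simpa [Real.dist_eq] using hφ.dist_le_mul x y

lemma abs_secondDiff_le {φ : ℝ → ℝ} (hφ : LipschitzWith 1 φ) {τ : ℝ} (hτ : 0 < τ) (x : ℝ) :
    |secondDiff τ φ x| ≤ 2 / τ := by
  have h1 := hφ.abs_sub_le_real (x + τ) x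
  have h2 := hφ.abs_sub_le_real (x - τ) x
  rw [add_sub_cancel_left, abs_of_pos hτ, abs_le] at h1
  rw [sub_sub_cancel_left, abs_neg, abs_of_pos hτ, abs_le] at h2
  have h3 : |φ (x + τ) - 2 * φ x + φ (x - τ)| ≤ 2 * τ := abs_le.2 ⟨by linarith, by linarith⟩
  rw [secondDiff, abs_div, abs_of_pos (pow_pos hτ 2), div_le_div_iff₀ (by positivity) hτ]
  nlinarith

lemma abs_secondDiff_sub_le {φ : ℝ → ℝ} (hφ : LipschitzWith 1 φ) {τ : ℝ} (hτ : 0 < τ)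
    (x y : ℝ) : |secondDiff τ φ x - secondDiff τ φ y| ≤ 4 / τ ^ 2 * |x - y| := by
  have h1 := abs_le.1 (hφ.abs_sub_le_real (x + τ) (y + τ))
  have h2 := abs_le.1 (hφ.abs_sub_le_real x y)
  have h3 := abs_le.1 (hφ.abs_sub_le_real (x - τ) (y - τ))
  rw [add_sub_add_right_eq_sub] at h1
  rw [sub_sub_sub_cancel_right] at h3
  rw [secondDiff, secondDiff, ← sub_div, abs_div, abs_of_pos (pow_pos hτ 2), div_mul_eq_mul_div]
  refine div_le_div_of_nonneg_right (abs_le.2 ⟨?_, ?_⟩) (by positivity) <;> linarith [h1.1, h1.2]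

/-- The linear bound on `G''` is integrated twice, each time by monotonicity of the difference, so
`G''` need not be integrable. With `b = 2` it yields the smoothing error. -/
lemma le_of_second_deriv_le {G G' G'' : ℝ → ℝ} (h1 : ∀ t, HasDerivAt G (G' t) t)
    (h2 : ∀ t, HasDerivAt G' (G'' t) t) (hG : G 0 = 0) (hG' : G' 0 = 0) {b : ℝ}
    (hb : ∀ t, 0 < t → G'' t ≤ b * t) {t : ℝ} (ht : 0 ≤ t) : G t ≤ b * t ^ 3 / 6 := by
  have m1 : ∀ s, 0 ≤ s → G' s ≤ b * s ^ 2 / 2 := by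
    intro s hs
    have hm : MonotoneOn (fun s => b * s ^ 2 / 2 - G' s) (Set.Ici 0) := by
      have hd : ∀ s, HasDerivAt (fun s => b * s ^ 2 / 2 - G' s) (b * s - G'' s) s := fun s =>
        ((((hasDerivAt_pow 2 s).const_mul b).div_const 2).sub (h2 s)).congr_deriv (by norm_num; ring)
      refine monotoneOn_of_deriv_nonneg (convex_Ici 0)
        (fun s _ => (hd s).continuousAt.continuousWithinAt)
        (fun s _ => (hd s).differentiableAt.differentiableWithinAt) fun s hs => ?_
      rw [interior_Ici] at hs
      rw [(hd s).deriv]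
      linarith [hb s hs]
    have := hm Set.self_mem_Ici hs hs
    simp only [hG'] at this
    linarith
  have hm : MonotoneOn (fun s => b * s ^ 3 / 6 - G s) (Set.Ici 0) := by
    have hd : ∀ s, HasDerivAt (fun s => b * s ^ 3 / 6 - G s) (b * s ^ 2 / 2 - G' s) s := fun s =>
      ((((hasDerivAt_pow 3 s).const_mul b).div_const 6).sub (h1 s)).congr_deriv (by norm_num; ring)
    refine monotoneOn_of_deriv_nonneg (convex_Ici 0)
      (fun s _ => (hd s).continuousAt.continuousWithinAt)
      (fun s _ => (hd s).differentiableAt.differentiableWithinAt) fun s hs => ?_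
    rw [interior_Ici] at hs
    rw [(hd s).deriv]
    linarith [m1 s (Set.mem_Ioi.1 hs).le]
  have := hm Set.self_mem_Ici ht ht
  simp only [hG] at this
  linarith

/-- As a function of the step `t`, the second difference of the double primitive minus `t² φ(x)`
vanishes to first order at `0` and has second derivative at most `2t` in absolute value. Two
integrations give `τ³/3`, and division by `τ²` gives the bound. -/
lemma abs_triangleSmooth_sub_le {φ : ℝ → ℝ} (hφ : LipschitzWith 1 φ) {τ : ℝ} (hτ : 0 < τ)
    (x : ℝ) : |triangleSmooth τ φ x - φ x| ≤ τ / 3 := by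
  have hc := hφ.continuous
  set Φ := primitive (primitive φ) with hΦ
  have d1 : ∀ y, HasDerivAt Φ (primitive φ y) y := hasDerivAt_primitive (continuous_primitive hc)
  have d2 : ∀ y, HasDerivAt (primitive φ) (φ y) y := hasDerivAt_primitive hc
  have e1 : ∀ t, HasDerivAt (fun t => Φ (x + t) - 2 * Φ x + Φ (x - t) - t ^ 2 * φ x)
      (primitive φ (x + t) - primitive φ (x - t) - 2 * t * φ x) t := fun t =>
    (((((d1 (x + t)).comp_const_add x t).sub_const (2 * Φ x)).add
      ((d1 (x - t)).comp_const_sub x t)).sub ((hasDerivAt_pow 2 t).mul_const (φ x))).congr_deriv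
      (by norm_num; ring)
  have e2 : ∀ t, HasDerivAt (fun t => primitive φ (x + t) - primitive φ (x - t) - 2 * t * φ x)
      (φ (x + t) + φ (x - t) - 2 * φ x) t := fun t =>
    ((((d2 (x + t)).comp_const_add x t)).sub ((d2 (x - t)).comp_const_sub x t)
      |>.sub (((hasDerivAt_id t).const_mul 2).mul_const (φ x))).congr_deriv (by ring)
  have hb : ∀ t, 0 < t → |φ (x + t) + φ (x - t) - 2 * φ x| ≤ 2 * t := fun t ht => by
    have h1 := hφ.abs_sub_le_real (x + t) x
    have h2 := hφ.abs_sub_le_real (x - t) x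
    rw [add_sub_cancel_left, abs_of_pos ht, abs_le] at h1
    rw [sub_sub_cancel_left, abs_neg, abs_of_pos ht, abs_le] at h2
    exact abs_le.2 ⟨by linarith, by linarith⟩
  have u1 := le_of_second_deriv_le e1 e2 (by simp; ring) (by simp)
    (fun t ht => (abs_le.1 (hb t ht)).2) hτ.le
  have u2 := le_of_second_deriv_le (fun t => (e1 t).neg) (fun t => (e2 t).neg) (by simp; ring)
    (by simp) (fun t ht => neg_le.1 (abs_le.1 (hb t ht)).1) hτ.le
  simp only [Pi.neg_apply] at u2
  have h3 : triangleSmooth τ φ x - φ x =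
      (Φ (x + τ) - 2 * Φ x + Φ (x - τ) - τ ^ 2 * φ x) / τ ^ 2 := by
    rw [triangleSmooth, secondDiff, ← hΦ]
    field_simp
  rw [h3, abs_div, abs_of_pos (pow_pos hτ 2), div_le_iff₀ (by positivity), abs_le]
  constructor <;> nlinarith

/-- The second difference is the increment over `[0, τ]` of the backward difference of the
primitive, whose derivative is an increment of `φ` of step `τ`, hence at most `τ`. -/
lemma abs_secondDiff_primitive_le {φ : ℝ → ℝ} (hφ : LipschitzWith 1 φ) {τ : ℝ} (hτ : 0 < τ)
    (x : ℝ) : |secondDiff τ (primitive φ) x| ≤ 1 := by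
  have hc := hφ.continuous
  have hd : ∀ t, HasDerivAt (fun t => primitive φ (x + t) - primitive φ (x + t - τ))
      (φ (x + t) - φ (x + t - τ)) t := fun t =>
    ((hasDerivAt_primitive hc (x + t)).comp_const_add x t).sub
      (((hasDerivAt_primitive hc (x + t - τ)).comp_sub_const (x + t) τ).comp_const_add x t)
  have hl := Convex.norm_image_sub_le_of_norm_hasDerivWithin_le (C := τ) (s := Set.Icc 0 τ)
    (fun t _ => (hd t).hasDerivWithinAt) (fun t _ => by
      have h := hφ.abs_sub_le_real (x + t) (x + t - τ)
      rwa [sub_sub_cancel, abs_of_pos hτ] at h) (convex_Icc 0 τ)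
    (Set.left_mem_Icc.2 hτ.le) (Set.right_mem_Icc.2 hτ.le)
  rw [secondDiff, abs_div, abs_of_pos (pow_pos hτ 2), div_le_one (by positivity)]
  rw [Real.norm_eq_abs, Real.norm_eq_abs, sub_zero, abs_of_pos hτ, add_sub_cancel_right,
    add_zero] at hl
  calc _ = |primitive φ (x + τ) - primitive φ x - (primitive φ x - primitive φ (x - τ))| := by
        ring_nf
    _ ≤ τ * τ := hl
    _ = τ ^ 2 := by ring

/-! ### Gaussian integration by parts -/

lemma hasDerivAt_gaussianPDFReal_standard (x : ℝ) :
    HasDerivAt (gaussianPDFReal 0 1) (-(x * gaussianPDFReal 0 1 x)) x := by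
  have h1 : HasDerivAt (fun x : ℝ => -(x - 0) ^ 2 / (2 * ((1 : NNReal) : ℝ))) (-x) x := by
    have := (((hasDerivAt_id x).sub_const 0).pow 2).neg.div_const (2 * ((1 : NNReal) : ℝ))
    refine this.congr_deriv ?_
    simp
    ring
  have h2 := h1.exp.const_mul (√(2 * Real.pi * ((1 : NNReal) : ℝ)))⁻¹
  rw [gaussianPDFReal_def]
  refine h2.congr_deriv ?_
  ring

lemma integrable_id_mul_gaussianPDFReal :
    Integrable (fun x : ℝ => x * gaussianPDFReal 0 1 x) := by
  have h := (integrable_mul_exp_neg_mul_sq (b := 1 / 2) (by norm_num)).const_mul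
    (√(2 * Real.pi * ((1 : NNReal) : ℝ)))⁻¹
  refine h.congr (Filter.Eventually.of_forall fun x => ?_)
  simp only [gaussianPDFReal_def, NNReal.coe_one]
  ring_nf

/-- Stein's identity for the standard Gaussian law. -/
lemma integral_id_mul_gaussianReal_eq {h h' : ℝ → ℝ} (hd : ∀ x, HasDerivAt h (h' x) x)
    (hc' : Continuous h') {C C' : ℝ} (hb : ∀ x, |h x| ≤ C) (hb' : ∀ x, |h' x| ≤ C') :
    ∫ n, n * h n ∂(gaussianReal 0 1) = ∫ n, h' n ∂(gaussianReal 0 1) := by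
  have hc : Continuous h := continuous_iff_continuousAt.2 fun x => (hd x).continuousAt
  rw [integral_gaussianReal_eq_integral_smul one_ne_zero,
    integral_gaussianReal_eq_integral_smul one_ne_zero]
  have key := integral_mul_deriv_eq_deriv_mul_of_integrable (u := h) (u' := h')
    (v := gaussianPDFReal 0 1) (v' := fun x => -(x * gaussianPDFReal 0 1 x))
    (fun x _ => hd x) (fun x _ => hasDerivAt_gaussianPDFReal_standard x)
    (integrable_id_mul_gaussianPDFReal.neg.bdd_mul hc.aestronglyMeasurable
      (Filter.Eventually.of_forall hb))
    ((integrable_gaussianPDFReal 0 1).bdd_mul hc'.aestronglyMeasurable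
      (Filter.Eventually.of_forall hb'))
    ((integrable_gaussianPDFReal 0 1).bdd_mul hc.aestronglyMeasurable
      (Filter.Eventually.of_forall hb))
  simp only [smul_eq_mul]
  calc ∫ x, gaussianPDFReal 0 1 x * (x * h x)
      = -∫ x, h x * -(x * gaussianPDFReal 0 1 x) := by
        rw [← integral_neg]; congr 1; ext x; ring
    _ = ∫ x, h' x * gaussianPDFReal 0 1 x := by rw [key, neg_neg]
    _ = _ := by congr 1; ext x; ring

lemma integrable_id_gaussianReal_standard : Integrable (fun n : ℝ => n) (gaussianReal 0 1) :=
  (memLp_id_gaussianReal' 1 (by simp)).integrable le_rfl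

lemma integrable_sq_gaussianReal_standard : Integrable (fun n : ℝ => n ^ 2) (gaussianReal 0 1) :=
  (memLp_id_gaussianReal' 2 (by simp)).integrable_sq

lemma integral_sq_gaussianReal_standard : ∫ n, n ^ 2 ∂(gaussianReal 0 1) = 1 := by
  have h := variance_id_gaussianReal (μ := 0) (v := 1)
  rw [variance_eq_integral (by fun_prop)] at h
  simpa [integral_id_gaussianReal] using h

/-- Testing a Lipschitz function of a Gaussian variable against that variable. -/
lemma abs_integral_id_mul_gaussianReal_le {g : ℝ → ℝ} {L : ℝ}
    (hg : ∀ x y, |g x - g y| ≤ L * |x - y|) (hgc : Continuous g) (x c : ℝ) :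
    |∫ n, n * g (x + c * n) ∂(gaussianReal 0 1)| ≤ L * |c| := by
  -- Subtracting the constant `g x` changes nothing, since the Gaussian is centred; the Lipschitz
  -- bound then leaves the second moment, which is `1`.
  have hb : ∀ n : ℝ, ‖n * (g (x + c * n) - g x)‖ ≤ L * |c| * n ^ 2 := fun n => by
    have h := hg (x + c * n) x
    rw [add_sub_cancel_left, abs_mul] at h
    rw [norm_mul, Real.norm_eq_abs, Real.norm_eq_abs]
    calc |n| * |g (x + c * n) - g x| ≤ |n| * (L * (|c| * |n|)) := by gcongr
      _ = L * |c| * |n| ^ 2 := by ring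
      _ = _ := by rw [sq_abs]
  have hi := integrable_sq_gaussianReal_standard.const_mul (L * |c|)
  have hi1 : Integrable (fun n : ℝ => n * (g (x + c * n) - g x)) (gaussianReal 0 1) :=
    hi.mono' (by fun_prop) (Filter.Eventually.of_forall hb)
  have hi2 : Integrable (fun n : ℝ => n * g x) (gaussianReal 0 1) :=
    integrable_id_gaussianReal_standard.mul_const _
  have e : ∫ n, n * g (x + c * n) ∂(gaussianReal 0 1) =
      ∫ n, n * (g (x + c * n) - g x) ∂(gaussianReal 0 1) := by
    have : ∫ n, n * g x ∂(gaussianReal 0 1) = 0 := by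
      rw [integral_mul_const, integral_id_gaussianReal, zero_mul]
    calc _ = ∫ n, (n * (g (x + c * n) - g x) + n * g x) ∂(gaussianReal 0 1) := by
          congr 1; ext n; ring
      _ = _ := by rw [integral_add hi1 hi2, this, add_zero]
  rw [e, ← Real.norm_eq_abs]
  refine (norm_integral_le_of_norm_le hi (Filter.Eventually.of_forall hb)).trans_eq ?_
  rw [integral_const_mul, integral_sq_gaussianReal_standard, mul_one]

/-! ### Interpolation between a divergence and a Gaussian mixture -/

/-- A test function `f` with two derivatives, the first one bounded by `1`, the second one
bounded by `M₂` and `M₃`-Lipschitz. -/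
structure IsSmoothTest (f f' f'' : ℝ → ℝ) (M₂ M₃ : ℝ) : Prop where
  deriv_one : ∀ x, HasDerivAt f (f' x) x
  deriv_two : ∀ x, HasDerivAt f' (f'' x) x
  bound_one : ∀ x, |f' x| ≤ 1
  bound_two : ∀ x, |f'' x| ≤ M₂
  lipschitz_two : ∀ x y, |f'' x - f'' y| ≤ M₃ * |x - y|

namespace IsSmoothTest

variable {f f' f'' : ℝ → ℝ} {M₂ M₃ : ℝ}

lemma nonneg_two (h : IsSmoothTest f f' f'' M₂ M₃) : 0 ≤ M₂ := (abs_nonneg _).trans (h.bound_two 0)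

lemma nonneg_three (h : IsSmoothTest f f' f'' M₂ M₃) : 0 ≤ M₃ := by
  simpa using (abs_nonneg _).trans (h.lipschitz_two 1 0)

lemma continuous_one (h : IsSmoothTest f f' f'' M₂ M₃) : Continuous f' :=
  continuous_iff_continuousAt.2 fun x => (h.deriv_two x).continuousAt

lemma continuous_two (h : IsSmoothTest f f' f'' M₂ M₃) : Continuous f'' :=
  (LipschitzWith.of_dist_le_mul (K := M₃.toNNReal) fun x y => by
    simpa [Real.dist_eq, h.nonneg_three] using h.lipschitz_two x y).continuous

lemma lipschitzWith (h : IsSmoothTest f f' f'' M₂ M₃) : LipschitzWith 1 f :=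
  lipschitzWith_of_nnnorm_deriv_le (fun x => (h.deriv_one x).differentiableAt) fun x => by
    rw [(h.deriv_one x).deriv, ← NNReal.coe_le_coe]; exact h.bound_one x

lemma lipschitzWith_one (h : IsSmoothTest f f' f'' M₂ M₃) :
    LipschitzWith M₂.toNNReal f' :=
  lipschitzWith_of_nnnorm_deriv_le (fun x => (h.deriv_two x).differentiableAt) fun x => by
    rw [(h.deriv_two x).deriv, ← NNReal.coe_le_coe, Real.coe_toNNReal _ h.nonneg_two]; exact h.bound_two x

/-- Taylor's formula for the first derivative of a test function. -/
lemma abs_taylor_le (h : IsSmoothTest f f' f'' M₂ M₃) (x y : ℝ) :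
    |f' (x + y) - f' x - f'' x * y| ≤ M₃ / 2 * y ^ 2 := by
  have hd : ∀ t, HasDerivAt (fun t => f' (x + t * y) - f' x - f'' x * (t * y))
      (f'' (x + t * y) * y - f'' x * y) t := fun t => by
    have h1 : HasDerivAt (fun t : ℝ => t * y) y t := by
      simpa using (hasDerivAt_id t).mul_const y
    exact (((h.deriv_two (x + t * y)).comp t (h1.const_add x)).sub_const (f' x)).sub
      (h1.const_mul (f'' x))
  have hB : ∀ t, HasDerivAt (fun t : ℝ => M₃ * y ^ 2 * (t ^ 2 / 2)) (M₃ * y ^ 2 * t) t := fun t =>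
    (((hasDerivAt_pow 2 t).div_const 2).const_mul (M₃ * y ^ 2)).congr_deriv (by norm_num)
  have := image_norm_le_of_norm_deriv_right_le_deriv_boundary (a := 0) (b := 1)
    (fun t _ => (hd t).continuousAt.continuousWithinAt)
    (fun t _ => (hd t).hasDerivWithinAt) (by simp) hB (fun t ht => by
      rw [← sub_mul, norm_mul, Real.norm_eq_abs, Real.norm_eq_abs]
      have h1 := h.lipschitz_two (x + t * y) x
      rw [add_sub_cancel_left, abs_mul, abs_of_nonneg ht.1] at h1
      calc |f'' (x + t * y) - f'' x| * |y| ≤ M₃ * (t * |y|) * |y| := by gcongr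
        _ = M₃ * |y| ^ 2 * t := by ring
        _ = _ := by rw [sq_abs]) (Set.right_mem_Icc.2 zero_le_one)
  rw [Real.norm_eq_abs] at this
  simp only [one_mul] at this
  linarith

end IsSmoothTest

/-- The second derivative of the smoothing is a difference quotient of `φ` itself, so both constants
follow from the Lipschitz property alone. -/
lemma isSmoothTest_triangleSmooth {φ : ℝ → ℝ} (hφ : LipschitzWith 1 φ) {τ : ℝ} (hτ : 0 < τ) :
    IsSmoothTest (triangleSmooth τ φ) (secondDiff τ (primitive φ)) (secondDiff τ φ)
      (2 / τ) (4 / τ ^ 2) where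
  deriv_one := hasDerivAt_triangleSmooth hφ.continuous τ
  deriv_two := hasDerivAt_secondDiff_primitive hφ.continuous τ
  bound_one := abs_secondDiff_primitive_le hφ hτ
  bound_two := abs_secondDiff_le hφ hτ
  lipschitz_two := abs_secondDiff_sub_le hφ hτ

/-- Square integrable variables `X` and `S` with increments `dX` and `dS`, where `X` is dual
to `U` along functions of `X` and `S`. -/
structure IsDualPair {Ω Z : Type*} [MeasurableSpace Ω] [MeasurableSpace Z] (P : Measure Ω)
    (ν : Measure Z) (X S : Ω → ℝ) (dX dS U : Ω × Z → ℝ) : Prop where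
  memLp_X : MemLp X 2 P
  memLp_S : MemLp S 2 P
  memLp_dX : MemLp dX 2 (P.prod ν)
  memLp_dS : MemLp dS 2 (P.prod ν)
  memLp_U : MemLp U 2 (P.prod ν)
  integrable_dX : Integrable (fun p => |U p| * dX p ^ 2) (P.prod ν)
  integrable_dS : Integrable (fun p => |U p| * dS p ^ 2) (P.prod ν)
  duality : ∀ (h : ℝ → ℝ) (K : NNReal) (C : ℝ), LipschitzWith K h → (∀ x, |h x| ≤ C) →
    ∀ a c : ℝ, ∫ ω, h (a * X ω + c * S ω) * X ω ∂P =
      ∫ p, U p * (h (a * X p.1 + c * S p.1 + (a * dX p + c * dS p)) - h (a * X p.1 + c * S p.1))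
        ∂(P.prod ν)

namespace IsDualPair

variable {Ω Z : Type*} [MeasurableSpace Ω] [MeasurableSpace Z] {P : Measure Ω}
  {ν : Measure Z} {X S : Ω → ℝ} {dX dS U : Ω × Z → ℝ} {f f' f'' : ℝ → ℝ} {M₂ M₃ : ℝ}

lemma integrable_U_mul_dX (h : IsDualPair P ν X S dX dS U) :
    Integrable (fun p => U p * dX p) (P.prod ν) := h.memLp_U.integrable_mul h.memLp_dX

lemma integrable_U_mul_dS (h : IsDualPair P ν X S dX dS U) :
    Integrable (fun p => U p * dS p) (P.prod ν) := h.memLp_U.integrable_mul h.memLp_dS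

lemma integrable_dX_mul_dS (h : IsDualPair P ν X S dX dS U) :
    Integrable (fun p => |U p| * (dX p * dS p)) (P.prod ν) := by
  refine (h.integrable_dX.add h.integrable_dS).mono'
    (h.memLp_U.1.norm.mul (h.memLp_dX.1.mul h.memLp_dS.1)) (Filter.Eventually.of_forall fun p => ?_)
  rw [norm_mul, norm_mul, Real.norm_eq_abs, Real.norm_eq_abs, Real.norm_eq_abs, abs_abs,
    Pi.add_apply, ← mul_add]
  refine mul_le_mul_of_nonneg_left ?_ (abs_nonneg _)
  nlinarith [sq_nonneg (|dX p| - |dS p|), sq_abs (dX p), sq_abs (dS p), abs_nonneg (dX p),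
    abs_nonneg (dS p)]

variable [IsProbabilityMeasure P] [SigmaFinite ν]

/-- The duality formula for `f' (a X + c S)`, expanded to second order. -/
lemma abs_integral_sub_le (h : IsDualPair P ν X S dX dS U) (hf : IsSmoothTest f f' f'' M₂ M₃)
    (a c : ℝ) :
    |∫ ω, f' (a * X ω + c * S ω) * X ω ∂P -
        a * ∫ ω, f'' (a * X ω + c * S ω) * ∫ z, U (ω, z) * dX (ω, z) ∂ν ∂P -
        c * ∫ ω, f'' (a * X ω + c * S ω) * ∫ z, U (ω, z) * dS (ω, z) ∂ν ∂P| ≤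
      M₃ / 2 * (a ^ 2 * ∫ p, |U p| * dX p ^ 2 ∂(P.prod ν) +
        2 * a * c * ∫ p, |U p| * (dX p * dS p) ∂(P.prod ν) +
        c ^ 2 * ∫ p, |U p| * dS p ^ 2 ∂(P.prod ν)) := by
  set W : Ω → ℝ := fun ω => a * X ω + c * S ω with hW
  set dW : Ω × Z → ℝ := fun p => a * dX p + c * dS p with hdW
  have hWm : AEStronglyMeasurable W P := (h.memLp_X.1.const_mul a).add (h.memLp_S.1.const_mul c)
  have hWm' : AEStronglyMeasurable (fun p : Ω × Z => W p.1) (P.prod ν) := hWm.comp_fst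
  have hdWm : MemLp dW 2 (P.prod ν) := (h.memLp_dX.const_mul a).add (h.memLp_dS.const_mul c)
  have hf''m : AEStronglyMeasurable (fun p : Ω × Z => f'' (W p.1)) (P.prod ν) :=
    hf.continuous_two.comp_aestronglyMeasurable hWm'
  have iX : Integrable (fun p : Ω × Z => f'' (W p.1) * (U p * dX p)) (P.prod ν) :=
    h.integrable_U_mul_dX.bdd_mul hf''m (Filter.Eventually.of_forall fun p => hf.bound_two _)
  have iS : Integrable (fun p : Ω × Z => f'' (W p.1) * (U p * dS p)) (P.prod ν) :=
    h.integrable_U_mul_dS.bdd_mul hf''m (Filter.Eventually.of_forall fun p => hf.bound_two _)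
  have iD : Integrable (fun p : Ω × Z => U p * (f' (W p.1 + dW p) - f' (W p.1))) (P.prod ν) := by
    have hm : AEStronglyMeasurable (fun p : Ω × Z => f' (W p.1 + dW p) - f' (W p.1)) (P.prod ν) :=
      (hf.continuous_one.comp_aestronglyMeasurable (hWm'.add hdWm.1)).sub
        (hf.continuous_one.comp_aestronglyMeasurable hWm')
    refine h.memLp_U.integrable_mul (hdWm.of_le_mul (c := M₂) hm
      (Filter.Eventually.of_forall fun p => ?_))
    simpa [dist_eq_norm, hf.nonneg_two] using hf.lipschitzWith_one.dist_le_mul (W p.1 + dW p) (W p.1)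
  have eX : ∫ ω, f'' (W ω) * ∫ z, U (ω, z) * dX (ω, z) ∂ν ∂P =
      ∫ p, f'' (W p.1) * (U p * dX p) ∂(P.prod ν) := by
    rw [integral_prod _ iX]
    simp only [integral_const_mul]
  have eS : ∫ ω, f'' (W ω) * ∫ z, U (ω, z) * dS (ω, z) ∂ν ∂P =
      ∫ p, f'' (W p.1) * (U p * dS p) ∂(P.prod ν) := by
    rw [integral_prod _ iS]
    simp only [integral_const_mul]
  -- `f'` is bounded and Lipschitz, hence admissible in the duality formula.
  have eD : ∫ ω, f' (W ω) * X ω ∂P =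
      ∫ p, U p * (f' (W p.1 + dW p) - f' (W p.1)) ∂(P.prod ν) :=
    h.duality f' _ 1 hf.lipschitzWith_one hf.bound_one a c
  have iDX : Integrable (fun p : Ω × Z => U p * (f' (W p.1 + dW p) - f' (W p.1)) -
    a * (f'' (W p.1) * (U p * dX p))) (P.prod ν) := iD.sub (iX.const_mul a)
  have i1 := h.integrable_dX.const_mul (a ^ 2)
  have i2 := h.integrable_dX_mul_dS.const_mul (2 * a * c)
  have i12 : Integrable (fun p => a ^ 2 * (|U p| * dX p ^ 2) +
    2 * a * c * (|U p| * (dX p * dS p))) (P.prod ν) := i1.add i2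
  have i3 := h.integrable_dS.const_mul (c ^ 2)
  rw [eX, eS, eD, ← integral_const_mul, ← integral_const_mul,
    ← integral_sub iD (iX.const_mul a), ← integral_sub iDX (iS.const_mul c),
    ← integral_const_mul, ← integral_const_mul, ← integral_const_mul, ← integral_add i1 i2,
    ← integral_add i12 i3, ← integral_const_mul, ← Real.norm_eq_abs]
  refine norm_integral_le_of_norm_le ((i12.add i3).const_mul _)
    (Filter.Eventually.of_forall fun p => ?_)
  -- The Taylor remainder involves the square of `a dX + c dS`. Its cross term keeps its sign in the
  -- final bound, so that it can cancel when `c` is later averaged over a centred Gaussian.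
  have ht := hf.abs_taylor_le (W p.1) (dW p)
  calc _ = |U p * (f' (W p.1 + dW p) - f' (W p.1) - f'' (W p.1) * dW p)| := by
        rw [Real.norm_eq_abs]; congr 1; simp only [hdW]; ring
    _ ≤ |U p| * (M₃ / 2 * dW p ^ 2) := by rw [abs_mul]; gcongr
    _ = _ := by simp only [hdW]; ring

end IsDualPair

namespace IsDualPair

variable {Ω Z : Type*} [MeasurableSpace Ω] [MeasurableSpace Z] {P : Measure Ω}
  {ν : Measure Z} {X S : Ω → ℝ} {dX dS U : Ω × Z → ℝ} {f f' f'' : ℝ → ℝ} {M₂ M₃ : ℝ}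

lemma aestronglyMeasurable_interpolation (h : IsDualPair P ν X S dX dS U) (a b : ℝ) :
    AEStronglyMeasurable (fun q : Ω × ℝ => a * X q.1 + b * q.2 * S q.1)
      (P.prod (gaussianReal 0 1)) :=
  (h.memLp_X.1.comp_fst.const_mul a).add
    ((by fun_prop : AEStronglyMeasurable (fun q : Ω × ℝ => b * q.2)
      (P.prod (gaussianReal 0 1))).mul h.memLp_S.1.comp_fst)

variable [IsProbabilityMeasure P]

lemma integrable_X (h : IsDualPair P ν X S dX dS U) : Integrable X P :=
  h.memLp_X.integrable one_le_two

lemma integrable_S (h : IsDualPair P ν X S dX dS U) : Integrable S P :=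
  h.memLp_S.integrable one_le_two

lemma integrable_gaussian_mul_S (h : IsDualPair P ν X S dX dS U) :
    Integrable (fun q : Ω × ℝ => q.2 * S q.1) (P.prod (gaussianReal 0 1)) :=
  (h.integrable_S.mul_prod integrable_id_gaussianReal_standard).congr
    (Filter.Eventually.of_forall fun _ => mul_comm _ _)

/-- Gaussian integration by parts in the interpolation. -/
lemma integral_mul_gaussian_mul_S (h : IsDualPair P ν X S dX dS U)
    (hf : IsSmoothTest f f' f'' M₂ M₃) (a b : ℝ) :
    ∫ q, f' (a * X q.1 + b * q.2 * S q.1) * (q.2 * S q.1) ∂(P.prod (gaussianReal 0 1)) =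
      b * ∫ q, f'' (a * X q.1 + b * q.2 * S q.1) * S q.1 ^ 2 ∂(P.prod (gaussianReal 0 1)) := by
  have hW := h.aestronglyMeasurable_interpolation a b
  have i1 : Integrable (fun q : Ω × ℝ => f' (a * X q.1 + b * q.2 * S q.1) * (q.2 * S q.1))
      (P.prod (gaussianReal 0 1)) :=
    h.integrable_gaussian_mul_S.bdd_mul (hf.continuous_one.comp_aestronglyMeasurable hW)
      (Filter.Eventually.of_forall fun q => hf.bound_one _)
  have i2 : Integrable (fun q : Ω × ℝ => f'' (a * X q.1 + b * q.2 * S q.1) * S q.1 ^ 2)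
      (P.prod (gaussianReal 0 1)) :=
    (h.memLp_S.integrable_sq.comp_fst _).bdd_mul
      (hf.continuous_two.comp_aestronglyMeasurable hW)
      (Filter.Eventually.of_forall fun q => hf.bound_two _)
  rw [integral_prod _ i1, integral_prod _ i2, ← integral_const_mul]
  congr 1
  ext ω
  have hd : ∀ n : ℝ, HasDerivAt (fun n => f' (a * X ω + b * n * S ω))
      (b * S ω * f'' (a * X ω + b * n * S ω)) n := fun n => by
    have h1 : HasDerivAt (fun n : ℝ => a * X ω + b * n * S ω) (b * S ω) n := by
      simpa using (((hasDerivAt_id n).const_mul b).mul_const (S ω)).const_add (a * X ω)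
    exact ((hf.deriv_two _).comp n h1).congr_deriv (mul_comm _ _)
  have hc := hf.continuous_two
  have key := integral_id_mul_gaussianReal_eq hd (by fun_prop) (C' := |b * S ω| * M₂)
    (fun n => hf.bound_one _) (fun n => by
      rw [abs_mul]
      exact mul_le_mul_of_nonneg_left (hf.bound_two _) (abs_nonneg _))
  rw [integral_const_mul] at key
  calc ∫ n, f' (a * X ω + b * n * S ω) * (n * S ω) ∂(gaussianReal 0 1)
      = (∫ n, n * f' (a * X ω + b * n * S ω) ∂(gaussianReal 0 1)) * S ω := by
        rw [← integral_mul_const]; congr 1; ext n; ring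
    _ = _ := by dsimp only; rw [key, integral_mul_const]; ring

/-- For fixed `ω` the function of `n` is Lipschitz with constant `M₃ b |S|` and is tested against a
centred variable. This stands in for an integration by parts, which would need a third derivative of
`f`. -/
lemma abs_integral_gaussian_mul_le (h : IsDualPair P ν X S dX dS U)
    (hf : IsSmoothTest f f' f'' M₂ M₃) (a : ℝ) {b : ℝ} (hb : 0 ≤ b) {T : Ω → ℝ}
    (hT : Integrable T P) (hST : Integrable (fun ω => S ω * T ω) P) :
    |∫ q, f'' (a * X q.1 + b * q.2 * S q.1) * (q.2 * T q.1) ∂(P.prod (gaussianReal 0 1))| ≤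
      b * M₃ * ∫ ω, |S ω * T ω| ∂P := by
  have hW := h.aestronglyMeasurable_interpolation a b
  have i1 : Integrable (fun q : Ω × ℝ => f'' (a * X q.1 + b * q.2 * S q.1) * (q.2 * T q.1))
      (P.prod (gaussianReal 0 1)) :=
    ((hT.mul_prod integrable_id_gaussianReal_standard).congr
      (Filter.Eventually.of_forall fun _ => mul_comm _ _)).bdd_mul
      (hf.continuous_two.comp_aestronglyMeasurable hW)
      (Filter.Eventually.of_forall fun q => hf.bound_two _)
  rw [integral_prod _ i1, ← integral_const_mul, ← Real.norm_eq_abs]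
  refine norm_integral_le_of_norm_le (hST.abs.const_mul _) (Filter.Eventually.of_forall fun ω => ?_)
  have key := abs_integral_id_mul_gaussianReal_le hf.lipschitz_two hf.continuous_two
    (a * X ω) (b * S ω)
  have e : ∫ n, f'' (a * X ω + b * n * S ω) * (n * T ω) ∂(gaussianReal 0 1) =
      (∫ n, n * f'' (a * X ω + b * S ω * n) ∂(gaussianReal 0 1)) * T ω := by
    rw [← integral_mul_const]; congr 1; ext n; ring_nf
  rw [e, norm_mul, Real.norm_eq_abs, Real.norm_eq_abs]
  calc _ ≤ M₃ * |b * S ω| * |T ω| := by gcongr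
    _ = _ := by rw [abs_mul, abs_of_nonneg hb, abs_mul]; ring

variable [SigmaFinite ν]

/-- The duality formula, expanded to second order and averaged over the Gaussian variable. -/
lemma abs_integral_prod_sub_le (h : IsDualPair P ν X S dX dS U)
    (hf : IsSmoothTest f f' f'' M₂ M₃) (a b : ℝ) :
    |∫ q, f' (a * X q.1 + b * q.2 * S q.1) * X q.1 ∂(P.prod (gaussianReal 0 1)) -
        a * ∫ q, f'' (a * X q.1 + b * q.2 * S q.1) * ∫ z, U (q.1, z) * dX (q.1, z) ∂ν
          ∂(P.prod (gaussianReal 0 1)) -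
        b * ∫ q, f'' (a * X q.1 + b * q.2 * S q.1) * (q.2 * ∫ z, U (q.1, z) * dS (q.1, z) ∂ν)
          ∂(P.prod (gaussianReal 0 1))| ≤
      M₃ / 2 * (a ^ 2 * ∫ p, |U p| * dX p ^ 2 ∂(P.prod ν) +
        b ^ 2 * ∫ p, |U p| * dS p ^ 2 ∂(P.prod ν)) := by
  have hW := h.aestronglyMeasurable_interpolation a b
  have hV := h.integrable_U_mul_dX.integral_prod_left
  have hV' := h.integrable_U_mul_dS.integral_prod_left
  have hW2 := hf.continuous_two.comp_aestronglyMeasurable hW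
  have i1 : Integrable (fun q : Ω × ℝ => f' (a * X q.1 + b * q.2 * S q.1) * X q.1)
      (P.prod (gaussianReal 0 1)) :=
    (h.integrable_X.comp_fst _).bdd_mul (hf.continuous_one.comp_aestronglyMeasurable hW)
      (Filter.Eventually.of_forall fun q => hf.bound_one _)
  have i2 : Integrable (fun q : Ω × ℝ => f'' (a * X q.1 + b * q.2 * S q.1) *
      ∫ z, U (q.1, z) * dX (q.1, z) ∂ν) (P.prod (gaussianReal 0 1)) :=
    (hV.comp_fst _).bdd_mul hW2 (Filter.Eventually.of_forall fun q => hf.bound_two _)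
  have i3 : Integrable (fun q : Ω × ℝ => f'' (a * X q.1 + b * q.2 * S q.1) *
      (q.2 * ∫ z, U (q.1, z) * dS (q.1, z) ∂ν)) (P.prod (gaussianReal 0 1)) :=
    ((hV'.mul_prod integrable_id_gaussianReal_standard).congr
      (Filter.Eventually.of_forall fun _ => mul_comm _ _)).bdd_mul hW2
      (Filter.Eventually.of_forall fun q => hf.bound_two _)
  let I₁ : ℝ → ℝ := fun n => ∫ ω, f' (a * X ω + b * n * S ω) * X ω ∂P
  let I₂ : ℝ → ℝ := fun n =>
    ∫ ω, f'' (a * X ω + b * n * S ω) * ∫ z, U (ω, z) * dX (ω, z) ∂ν ∂P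
  let I₃ : ℝ → ℝ := fun n =>
    ∫ ω, f'' (a * X ω + b * n * S ω) * (n * ∫ z, U (ω, z) * dS (ω, z) ∂ν) ∂P
  have j1 : Integrable I₁ (gaussianReal 0 1) := i1.integral_prod_right
  have j2 : Integrable (fun n => a * I₂ n) (gaussianReal 0 1) :=
    i2.integral_prod_right.const_mul a
  have j3 : Integrable (fun n => b * I₃ n) (gaussianReal 0 1) :=
    i3.integral_prod_right.const_mul b
  have j12 : Integrable (fun n => I₁ n - a * I₂ n) (gaussianReal 0 1) := j1.sub j2
  have e1 := integral_prod_symm _ i1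
  have e2 := integral_prod_symm _ i2
  have e3 := integral_prod_symm _ i3
  have e : (∫ n, I₁ n ∂(gaussianReal 0 1)) - a * (∫ n, I₂ n ∂(gaussianReal 0 1)) -
      b * (∫ n, I₃ n ∂(gaussianReal 0 1)) =
      ∫ n, (I₁ n - a * I₂ n - b * I₃ n) ∂(gaussianReal 0 1) := by
    rw [integral_sub j12 j3, integral_sub j1 j2, integral_const_mul, integral_const_mul]
  set CX := ∫ p, |U p| * dX p ^ 2 ∂(P.prod ν)
  set CXS := ∫ p, |U p| * (dX p * dS p) ∂(P.prod ν)
  set CS := ∫ p, |U p| * dS p ^ 2 ∂(P.prod ν)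
  have iB1 : Integrable (fun n : ℝ => a ^ 2 * CX + n * (2 * a * b * CXS)) (gaussianReal 0 1) :=
    (integrable_const _).add (integrable_id_gaussianReal_standard.mul_const _)
  have iB2 : Integrable (fun n : ℝ => n ^ 2 * (b ^ 2 * CS)) (gaussianReal 0 1) :=
    integrable_sq_gaussianReal_standard.mul_const _
  -- The cross term is linear in `n` and averages to zero; the quadratic term has mean `b² CS`.
  have eB : ∫ n : ℝ, M₃ / 2 * (a ^ 2 * CX + n * (2 * a * b * CXS) + n ^ 2 * (b ^ 2 * CS))
      ∂(gaussianReal 0 1) = M₃ / 2 * (a ^ 2 * CX + b ^ 2 * CS) := by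
    rw [integral_const_mul, integral_add iB1 iB2, integral_add (integrable_const _)
      (integrable_id_gaussianReal_standard.mul_const _), integral_mul_const (2 * a * b * CXS),
      integral_mul_const (b ^ 2 * CS), integral_id_gaussianReal, integral_sq_gaussianReal_standard]
    simp
  rw [← eB, e1, e2, e3]
  refine (congrArg abs e).trans_le ?_
  rw [← Real.norm_eq_abs]
  refine norm_integral_le_of_norm_le ((iB1.add iB2).const_mul _)
    (Filter.Eventually.of_forall fun n => ?_)
  -- The Gaussian variable is frozen at `n`, so the coefficient of `S` is the constant `b n`.
  have key := h.abs_integral_sub_le hf a (b * n)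
  have e4 : I₃ n =
      n * ∫ ω, f'' (a * X ω + b * n * S ω) * ∫ z, U (ω, z) * dS (ω, z) ∂ν ∂P := by
    rw [← integral_const_mul]
    exact integral_congr_ae (Filter.Eventually.of_forall fun ω => mul_left_comm _ _ _)
  rw [e4, ← mul_assoc, Real.norm_eq_abs]
  refine key.trans_eq ?_
  ring

/-- The bound of the derivative along the interpolation. -/
lemma abs_integral_derivative_le (h : IsDualPair P ν X S dX dS U)
    (hf : IsSmoothTest f f' f'' M₂ M₃)
    (hB : Integrable (fun ω => S ω * ∫ z, U (ω, z) * dS (ω, z) ∂ν) P)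
    {a b : ℝ} (ha : 0 ≤ a) (hb : 0 ≤ b) :
    |∫ q, f' (a * X q.1 + b * q.2 * S q.1) * (b * X q.1 - a * (q.2 * S q.1))
        ∂(P.prod (gaussianReal 0 1))| ≤
      a * b * (M₂ * ∫ ω, |(∫ z, U (ω, z) * dX (ω, z) ∂ν) - S ω ^ 2| ∂P) +
      b ^ 3 * (M₃ * ∫ ω, |S ω * ∫ z, U (ω, z) * dS (ω, z) ∂ν| ∂P) +
      b * (M₃ / 2 * (a ^ 2 * ∫ p, |U p| * dX p ^ 2 ∂(P.prod ν) +
        b ^ 2 * ∫ p, |U p| * dS p ^ 2 ∂(P.prod ν))) := by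
  have hW := h.aestronglyMeasurable_interpolation a b
  have hW1 := hf.continuous_one.comp_aestronglyMeasurable hW
  have hW2 := hf.continuous_two.comp_aestronglyMeasurable hW
  have hV := h.integrable_U_mul_dX.integral_prod_left
  have hVS : Integrable (fun ω => (∫ z, U (ω, z) * dX (ω, z) ∂ν) - S ω ^ 2) P :=
    hV.sub h.memLp_S.integrable_sq
  have i1 : Integrable (fun q : Ω × ℝ => f' (a * X q.1 + b * q.2 * S q.1) * X q.1)
      (P.prod (gaussianReal 0 1)) :=
    (h.integrable_X.comp_fst _).bdd_mul hW1 (Filter.Eventually.of_forall fun q => hf.bound_one _)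
  have i2 : Integrable (fun q : Ω × ℝ => f' (a * X q.1 + b * q.2 * S q.1) * (q.2 * S q.1))
      (P.prod (gaussianReal 0 1)) :=
    h.integrable_gaussian_mul_S.bdd_mul hW1 (Filter.Eventually.of_forall fun q => hf.bound_one _)
  have i3 : Integrable (fun q : Ω × ℝ => f'' (a * X q.1 + b * q.2 * S q.1) *
      ∫ z, U (q.1, z) * dX (q.1, z) ∂ν) (P.prod (gaussianReal 0 1)) :=
    (hV.comp_fst _).bdd_mul hW2 (Filter.Eventually.of_forall fun q => hf.bound_two _)
  have i4 : Integrable (fun q : Ω × ℝ => f'' (a * X q.1 + b * q.2 * S q.1) * S q.1 ^ 2)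
      (P.prod (gaussianReal 0 1)) :=
    (h.memLp_S.integrable_sq.comp_fst _).bdd_mul hW2
      (Filter.Eventually.of_forall fun q => hf.bound_two _)
  have e1 : ∫ q, f' (a * X q.1 + b * q.2 * S q.1) * (b * X q.1 - a * (q.2 * S q.1))
      ∂(P.prod (gaussianReal 0 1)) =
      b * ∫ q, f' (a * X q.1 + b * q.2 * S q.1) * X q.1 ∂(P.prod (gaussianReal 0 1)) -
      a * ∫ q, f' (a * X q.1 + b * q.2 * S q.1) * (q.2 * S q.1) ∂(P.prod (gaussianReal 0 1)) := by
    rw [← integral_const_mul, ← integral_const_mul, ← integral_sub (i1.const_mul b) (i2.const_mul a)]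
    congr 1; ext q; ring
  have k1 := h.abs_integral_prod_sub_le hf a b
  have k2 := h.abs_integral_gaussian_mul_le hf a hb h.integrable_U_mul_dS.integral_prod_left hB
  have k3 : |∫ q, f'' (a * X q.1 + b * q.2 * S q.1) * ∫ z, U (q.1, z) * dX (q.1, z) ∂ν
        ∂(P.prod (gaussianReal 0 1)) -
      ∫ q, f'' (a * X q.1 + b * q.2 * S q.1) * S q.1 ^ 2 ∂(P.prod (gaussianReal 0 1))| ≤
      M₂ * ∫ ω, |(∫ z, U (ω, z) * dX (ω, z) ∂ν) - S ω ^ 2| ∂P := by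
    have e : ∫ q, |(∫ z, U (q.1, z) * dX (q.1, z) ∂ν) - S q.1 ^ 2| ∂(P.prod (gaussianReal 0 1)) =
        ∫ ω, |(∫ z, U (ω, z) * dX (ω, z) ∂ν) - S ω ^ 2| ∂P := by
      rw [integral_fun_fst (fun ω => |(∫ z, U (ω, z) * dX (ω, z) ∂ν) - S ω ^ 2|)]
      simp
    rw [← integral_sub i3 i4, ← e, ← integral_const_mul, ← Real.norm_eq_abs]
    refine norm_integral_le_of_norm_le ((hVS.abs.comp_fst _).const_mul _)
      (Filter.Eventually.of_forall fun q => ?_)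
    rw [← mul_sub, norm_mul, Real.norm_eq_abs, Real.norm_eq_abs]
    exact mul_le_mul_of_nonneg_right (hf.bound_two _) (abs_nonneg _)
  -- Gaussian integration by parts produces `a b E f''(W) S²`, to be matched with the `a b` term of
  -- the duality expansion. The three estimates enter with weights `b`, `b²` and `a b`.
  rw [e1, h.integral_mul_gaussian_mul_S hf a b]
  have hab := mul_nonneg ha hb
  have hbb := mul_nonneg hb hb
  rw [abs_le] at k1 k2 k3 ⊢
  have m1 := mul_le_mul_of_nonneg_left k1.1 hb
  have m1' := mul_le_mul_of_nonneg_left k1.2 hb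
  have m2 := mul_le_mul_of_nonneg_left k2.1 hbb
  have m2' := mul_le_mul_of_nonneg_left k2.2 hbb
  have m3 := mul_le_mul_of_nonneg_left k3.1 hab
  have m3' := mul_le_mul_of_nonneg_left k3.2 hab
  constructor <;> linarith

/-- The comparison of `X` with the Gaussian mixture of variance `S ^ 2`, for test functions. -/
theorem integral_mixture_sub_integral_le (h : IsDualPair P ν X S dX dS U)
    (hf : IsSmoothTest f f' f'' M₂ M₃)
    (hB : Integrable (fun ω => S ω * ∫ z, U (ω, z) * dS (ω, z) ∂ν) P) :
    ∫ q, f (q.2 * S q.1) ∂(P.prod (gaussianReal 0 1)) - ∫ ω, f (X ω) ∂P ≤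
      M₂ / 2 * ∫ ω, |(∫ z, U (ω, z) * dX (ω, z) ∂ν) - S ω ^ 2| ∂P +
      M₃ * (2 / 3 * ∫ ω, |S ω * ∫ z, U (ω, z) * dS (ω, z) ∂ν| ∂P +
        1 / 6 * ∫ p, |U p| * dX p ^ 2 ∂(P.prod ν) + 1 / 3 * ∫ p, |U p| * dS p ^ 2 ∂(P.prod ν)) := by
  set A := ∫ ω, |(∫ z, U (ω, z) * dX (ω, z) ∂ν) - S ω ^ 2| ∂P
  set B := ∫ ω, |S ω * ∫ z, U (ω, z) * dS (ω, z) ∂ν| ∂P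
  set CX := ∫ p, |U p| * dX p ^ 2 ∂(P.prod ν)
  set CS := ∫ p, |U p| * dS p ^ 2 ∂(P.prod ν)
  -- A rotation keeps the path differentiable up to both ends, with a derivative dominated by `|X| +
  -- |N S|` uniformly in `θ`.
  let W : ℝ → Ω × ℝ → ℝ := fun θ q => Real.sin θ * X q.1 + Real.cos θ * q.2 * S q.1
  let W' : ℝ → Ω × ℝ → ℝ := fun θ q => Real.cos θ * X q.1 - Real.sin θ * (q.2 * S q.1)
  have hW : ∀ θ, AEStronglyMeasurable (W θ) (P.prod (gaussianReal 0 1)) := fun θ =>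
    h.aestronglyMeasurable_interpolation _ _
  have iX : Integrable (fun q : Ω × ℝ => X q.1) (P.prod (gaussianReal 0 1)) :=
    h.integrable_X.comp_fst _
  have iS := h.integrable_gaussian_mul_S
  have iW : ∀ θ, Integrable (W θ) (P.prod (gaussianReal 0 1)) := fun θ =>
    ((iX.const_mul (Real.sin θ)).add (iS.const_mul (Real.cos θ))).congr
      (Filter.Eventually.of_forall fun q => by simp only [W, Pi.add_apply]; ring)
  have iW' : ∀ θ, Integrable (W' θ) (P.prod (gaussianReal 0 1)) := fun θ =>
    (iX.const_mul (Real.cos θ)).sub (iS.const_mul (Real.sin θ))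
  have dW : ∀ θ q, HasDerivAt (fun θ => W θ q) (W' θ q) θ := fun θ q =>
    (((Real.hasDerivAt_sin θ).mul_const (X q.1)).add
      (((Real.hasDerivAt_cos θ).mul_const q.2).mul_const (S q.1))).congr_deriv
      (by simp only [W']; ring)
  have dΨ : ∀ θ, HasDerivAt (fun θ => ∫ q, f (W θ q) ∂(P.prod (gaussianReal 0 1)))
      (∫ q, f' (W θ q) * W' θ q ∂(P.prod (gaussianReal 0 1))) θ := fun θ => by
    refine (hasDerivAt_integral_of_dominated_loc_of_deriv_le (s := Set.univ)
      (bound := fun q => |X q.1| + |q.2 * S q.1|) Filter.univ_mem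
      (Filter.Eventually.of_forall fun θ =>
        hf.lipschitzWith.continuous.comp_aestronglyMeasurable (hW θ))
      (hf.lipschitzWith.integrable_comp_real (iW θ))
      ((hf.continuous_one.comp_aestronglyMeasurable (hW θ)).mul (iW' θ).1)
      (Filter.Eventually.of_forall fun q θ _ => ?_) (iX.abs.add iS.abs)
      (Filter.Eventually.of_forall fun q θ _ => (hf.deriv_one _).comp θ (dW θ q))).2
    rw [norm_mul, Real.norm_eq_abs, Real.norm_eq_abs]
    calc |f' (W θ q)| * |W' θ q| ≤ 1 * (|Real.cos θ * X q.1| + |Real.sin θ * (q.2 * S q.1)|) :=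
          mul_le_mul (hf.bound_one _) (abs_sub _ _) (abs_nonneg _) zero_le_one
      _ ≤ 1 * (1 * |X q.1| + 1 * |q.2 * S q.1|) := by
          rw [abs_mul (Real.cos θ), abs_mul (Real.sin θ)]
          gcongr
          · exact Real.abs_cos_le_one θ
          · exact Real.abs_sin_le_one θ
      _ = _ := by ring
  -- An explicit antiderivative, vanishing at `0`, of the bound on the derivative. Its value at
  -- `π/2` supplies the factors `1/2`, `2/3`, `1/6`, `1/3`.
  let G : ℝ → ℝ := fun θ => Real.sin θ ^ 2 / 2 * (M₂ * A) +
    (Real.sin θ - Real.sin θ ^ 3 / 3) * (M₃ * B + M₃ / 2 * CS) +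
    Real.sin θ ^ 3 / 3 * (M₃ / 2 * CX)
  have dG : ∀ θ, HasDerivAt G (Real.sin θ * Real.cos θ * (M₂ * A) +
      Real.cos θ ^ 3 * (M₃ * B) + Real.cos θ * (M₃ / 2 * (Real.sin θ ^ 2 * CX +
        Real.cos θ ^ 2 * CS))) θ := fun θ => by
    have h1 := Real.hasDerivAt_sin θ
    have h3 := (h1.pow 3).div_const 3
    refine ((((h1.pow 2).div_const 2).mul_const (M₂ * A)).add
      ((h1.sub h3).mul_const (M₃ * B + M₃ / 2 * CS))|>.add
      (h3.mul_const (M₃ / 2 * CX))).congr_deriv ?_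
    have hs : Real.sin θ ^ 2 = 1 - Real.cos θ ^ 2 := by rw [Real.sin_sq]
    norm_num
    rw [hs]
    ring
  -- Monotonicity replaces integration in `θ`, so the derivative need not be shown integrable.
  have hm : MonotoneOn (fun θ => (∫ q, f (W θ q) ∂(P.prod (gaussianReal 0 1))) + G θ)
      (Set.Icc 0 (Real.pi / 2)) := by
    refine monotoneOn_of_deriv_nonneg (convex_Icc _ _)
      (fun θ _ => ((dΨ θ).add (dG θ)).continuousAt.continuousWithinAt)
      (fun θ _ => ((dΨ θ).add (dG θ)).differentiableAt.differentiableWithinAt) fun θ hθ => ?_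
    rw [interior_Icc] at hθ
    have hsin : 0 ≤ Real.sin θ :=
      Real.sin_nonneg_of_nonneg_of_le_pi hθ.1.le (by linarith [hθ.2, Real.pi_pos])
    have hcos : 0 ≤ Real.cos θ :=
      Real.cos_nonneg_of_neg_pi_div_two_le_of_le (by linarith [hθ.1, Real.pi_pos]) hθ.2.le
    have key := (abs_le.1 (h.abs_integral_derivative_le hf hB hsin hcos)).1
    have hd : deriv (fun θ => (∫ q, f (W θ q) ∂(P.prod (gaussianReal 0 1))) + G θ) θ = _ :=
      ((dΨ θ).add (dG θ)).deriv
    rw [hd]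
    simp only [W, W']
    linarith
  have hpi : (0 : ℝ) ≤ Real.pi / 2 := by positivity
  have hmono := hm (Set.left_mem_Icc.2 hpi) (Set.right_mem_Icc.2 hpi) hpi
  have e0 : ∫ q, f (W 0 q) ∂(P.prod (gaussianReal 0 1)) =
      ∫ q, f (q.2 * S q.1) ∂(P.prod (gaussianReal 0 1)) := by
    simp [W]
  have e1 : ∫ q, f (W (Real.pi / 2) q) ∂(P.prod (gaussianReal 0 1)) = ∫ ω, f (X ω) ∂P := by
    simp only [W, Real.sin_pi_div_two, Real.cos_pi_div_two, one_mul, zero_mul, add_zero]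
    rw [integral_fun_fst (fun ω => f (X ω))]
    simp
  simp only [e0, e1, G, Real.sin_zero, Real.sin_pi_div_two] at hmono
  linarith

end IsDualPair

/-! ### Transport bounds -/

/-- From `|n| ≤ (1 + n²)/2`; the exact value `√(2/π)` is not needed for the moment bound. -/
lemma integral_abs_gaussianReal_standard_le : ∫ n, |n| ∂(gaussianReal 0 1) ≤ 1 := by
  have h : ∫ n, |n| ∂(gaussianReal 0 1) ≤ ∫ n : ℝ, (1 / 2 + n ^ 2 * (1 / 2)) ∂(gaussianReal 0 1) :=
    integral_mono integrable_id_gaussianReal_standard.abs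
      ((integrable_const _).add (integrable_sq_gaussianReal_standard.mul_const _)) fun n => by
        nlinarith [sq_nonneg (|n| - 1), sq_abs n]
  rw [integral_add (integrable_const _) (integrable_sq_gaussianReal_standard.mul_const _),
    integral_mul_const (1 / 2 : ℝ), integral_sq_gaussianReal_standard] at h
  refine h.trans_eq ?_
  norm_num

namespace IsDualPair

variable {Ω Z : Type*} [MeasurableSpace Ω] [MeasurableSpace Z] {P : Measure Ω}
  {ν : Measure Z} {X S : Ω → ℝ} {dX dS U : Ω × Z → ℝ} [IsProbabilityMeasure P]

lemma mongeKantorovich_gaussianMixture_le (h : IsDualPair P ν X S dX dS U) {c : ℝ}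
    (hc : ∀ φ : ℝ → ℝ, LipschitzWith 1 φ →
      ∫ q, φ (q.2 * S q.1) ∂(P.prod (gaussianReal 0 1)) - ∫ ω, φ (X ω) ∂P ≤ c) :
    mongeKantorovich (P.map X) (gaussianMixture P S) ≤ ENNReal.ofReal c := by
  have hX := h.memLp_X.1.aemeasurable
  have iS : Integrable (fun q : Ω × ℝ => S q.1 * q.2) (P.prod (gaussianReal 0 1)) :=
    h.integrable_S.mul_prod integrable_id_gaussianReal_standard
  have hS := iS.1.aemeasurable
  have : IsProbabilityMeasure (P.map X) := Measure.isProbabilityMeasure_map hX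
  have : IsProbabilityMeasure (gaussianMixture P S) := Measure.isProbabilityMeasure_map hS
  refine mongeKantorovich_le_of_lipschitz ?_ ?_ fun φ hφ => ?_
  · exact (integrable_map_measure (by fun_prop) hX).2 h.integrable_X
  · exact (integrable_map_measure (by fun_prop) hS).2 iS
  · rw [gaussianMixture, integral_map hX hφ.continuous.aestronglyMeasurable,
      integral_map hS hφ.continuous.aestronglyMeasurable]
    simpa only [mul_comm] using hc φ hφ

/-- Both laws are compared with the point mass at `0`. This covers the regime where smoothing is not
small. -/
lemma mongeKantorovich_le_moments (h : IsDualPair P ν X S dX dS U) :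
    mongeKantorovich (P.map X) (gaussianMixture P S) ≤
      ENNReal.ofReal (∫ ω, |X ω| ∂P + ∫ ω, |S ω| ∂P) := by
  refine h.mongeKantorovich_gaussianMixture_le fun φ hφ => ?_
  have iS := h.integrable_gaussian_mul_S
  have i1 := hφ.integrable_comp_real iS
  have i2 := hφ.integrable_comp_real h.integrable_X
  have b1 : ∫ q, φ (q.2 * S q.1) ∂(P.prod (gaussianReal 0 1)) ≤
      ∫ q, (φ 0 + |q.2 * S q.1|) ∂(P.prod (gaussianReal 0 1)) :=
    integral_mono i1 ((integrable_const _).add iS.abs) fun q => by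
      have := (abs_le.1 (hφ.abs_sub_le_real (q.2 * S q.1) 0)).2
      rw [sub_zero] at this
      linarith
  have b2 : ∫ ω, (φ 0 - |X ω|) ∂P ≤ ∫ ω, φ (X ω) ∂P :=
    integral_mono ((integrable_const _).sub h.integrable_X.abs) i2 fun ω => by
      have := (abs_le.1 (hφ.abs_sub_le_real (X ω) 0)).1
      rw [sub_zero] at this
      linarith
  rw [integral_add (integrable_const _) iS.abs] at b1
  rw [integral_sub (integrable_const _) h.integrable_X.abs] at b2
  have e : ∫ q : Ω × ℝ, |q.2 * S q.1| ∂(P.prod (gaussianReal 0 1)) ≤ ∫ ω, |S ω| ∂P := by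
    have : ∫ q : Ω × ℝ, |q.2 * S q.1| ∂(P.prod (gaussianReal 0 1)) =
        (∫ ω, |S ω| ∂P) * ∫ n, |n| ∂(gaussianReal 0 1) := by
      rw [← integral_prod_mul]
      congr 1; ext q; rw [abs_mul, mul_comm]
    rw [this]
    exact mul_le_of_le_one_right (integral_nonneg fun _ => abs_nonneg _)
      integral_abs_gaussianReal_standard_le
  simp only [integral_const, probReal_univ, one_smul] at b1 b2
  linarith

variable [SigmaFinite ν]

/-- Smoothing costs `τ/3` for each law; the rest is the test function estimate with `M₂ = 2/τ` and
`M₃ = 4/τ²`. -/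
lemma mongeKantorovich_le_smoothing (h : IsDualPair P ν X S dX dS U)
    (hB : Integrable (fun ω => S ω * ∫ z, U (ω, z) * dS (ω, z) ∂ν) P) {τ : ℝ} (hτ : 0 < τ) :
    mongeKantorovich (P.map X) (gaussianMixture P S) ≤
      ENNReal.ofReal (2 / 3 * τ + (∫ ω, |(∫ z, U (ω, z) * dX (ω, z) ∂ν) - S ω ^ 2| ∂P) / τ +
        4 / τ ^ 2 * (2 / 3 * ∫ ω, |S ω * ∫ z, U (ω, z) * dS (ω, z) ∂ν| ∂P +
        1 / 6 * ∫ p, |U p| * dX p ^ 2 ∂(P.prod ν) +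
        1 / 3 * ∫ p, |U p| * dS p ^ 2 ∂(P.prod ν))) := by
  refine h.mongeKantorovich_gaussianMixture_le fun φ hφ => ?_
  have hf := isSmoothTest_triangleSmooth hφ hτ
  have key := h.integral_mixture_sub_integral_le hf hB
  have iS := h.integrable_gaussian_mul_S
  have b1 : ∫ q, φ (q.2 * S q.1) ∂(P.prod (gaussianReal 0 1)) ≤
      ∫ q, (triangleSmooth τ φ (q.2 * S q.1) + τ / 3) ∂(P.prod (gaussianReal 0 1)) :=
    integral_mono (hφ.integrable_comp_real iS)
      ((hf.lipschitzWith.integrable_comp_real iS).add (integrable_const _)) fun q => by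
      linarith [(abs_le.1 (abs_triangleSmooth_sub_le hφ hτ (q.2 * S q.1))).1]
  have b2 : ∫ ω, (triangleSmooth τ φ (X ω) - τ / 3) ∂P ≤ ∫ ω, φ (X ω) ∂P :=
    integral_mono ((hf.lipschitzWith.integrable_comp_real h.integrable_X).sub (integrable_const _))
      (hφ.integrable_comp_real h.integrable_X) fun ω => by
      linarith [(abs_le.1 (abs_triangleSmooth_sub_le hφ hτ (X ω))).2]
  rw [integral_add (hf.lipschitzWith.integrable_comp_real iS) (integrable_const _)] at b1
  rw [integral_sub (hf.lipschitzWith.integrable_comp_real h.integrable_X)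
    (integrable_const _)] at b2
  simp only [integral_const, probReal_univ, one_smul] at b1 b2
  have e : 2 / τ / 2 * ∫ ω, |(∫ z, U (ω, z) * dX (ω, z) ∂ν) - S ω ^ 2| ∂P =
      (∫ ω, |(∫ z, U (ω, z) * dX (ω, z) ∂ν) - S ω ^ 2| ∂P) / τ := by ring
  rw [e] at key
  linarith

end IsDualPair

/-! ### Optimization of the smoothing parameter -/

/-- With `τ = 3κσ` and `κ²π = 2`, the coefficient of `X/σ²` becomes `2√2π/9`, just below `1`. The
coefficient of `Y/σ` is `2π/3`, and the excess that this causes for large `σ` is paid for by `hps`,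
which limits `σ`. -/
lemma smoothing_bound_le {κ p s A X σ : ℝ} (hκ : κ = √(2 / Real.pi)) (hp : 0 ≤ p) (hs : 0 ≤ s)
    (hA : 0 ≤ A) (hX : 0 ≤ X) (hσ : 0 < σ)
    (h : 2 * (1 / 4 * κ * A + X) = σ ^ 3 * (κ * (2 + s) + p))
    (hps : 3 / 2 * σ * (κ * (2 + s) + p) < p + s) :
    2 / 3 * (3 * κ * σ) + A / (3 * κ * σ) + 4 * √2 * X / (3 * κ * σ) ^ 2 ≤
      3 / 2 * σ * (κ * (2 + s) + p) := by
  have hπ := Real.pi_pos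
  have hπ1 := Real.pi_gt_d2
  have hπ2 := Real.pi_lt_d4
  have hκ0 : 0 < κ := by rw [hκ]; positivity
  have hκ2 : κ ^ 2 * Real.pi = 2 := by
    rw [hκ, Real.sq_sqrt (by positivity)]; field_simp
  have hκ1 : κ ≤ 1 := by nlinarith
  have hκ3 : 79 / 100 ≤ κ := by nlinarith
  have h2 : √2 ≤ 1.4143 := Real.sqrt_le_iff.2 ⟨by norm_num, by norm_num⟩
  set D := κ * (2 + s) + p with hD
  set Y := 1 / 4 * κ * A with hY
  have hY0 : 0 ≤ Y := by positivity
  have hD0 : 0 < D := by positivity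
  have e1 : A / (3 * κ * σ) = 2 * Real.pi / 3 * Y / σ := by
    rw [hY]; field_simp; linear_combination (-2 * A) * hκ2
  have e2 : 4 * √2 * X / (3 * κ * σ) ^ 2 = 2 * √2 * Real.pi / 9 * X / σ ^ 2 := by
    field_simp; linear_combination (-18 * X) * hκ2
  have hc : 2 * √2 * Real.pi / 9 ≤ 1 := by nlinarith [Real.sqrt_nonneg 2]
  rw [e1, e2]
  -- Since `κ ≤ 1`, `κ (p + s) ≤ p + κ s = D - 2κ`. With `hps` this bounds `κ σ` strictly below
  -- `2/3`.
  have hm : κ * (p + s) ≤ D - 2 * κ := by rw [hD]; nlinarith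
  have hm2 : κ * (3 / 2 * σ * D) ≤ D - 2 * κ :=
    (mul_le_mul_of_nonneg_left hps.le hκ0.le).trans hm
  have hσD : 0 < σ * D := by positivity
  have hYle : 2 * Y ≤ σ ^ 3 * D := by linarith
  have key : 2 * κ * σ ^ 3 + 2 * Real.pi / 3 * σ * Y + X ≤ 3 / 2 * σ ^ 3 * D := by
    -- This suffices because `Y + X = σ³ D / 2` by `h`.
    have a1 : 2 * Real.pi / 3 * σ * Y ≤ Y + σ ^ 3 * (D - 2 * κ) := by
      rcases le_total (2 * Real.pi / 3 * σ) 1 with hσ1 | hσ1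
      · have : 0 ≤ D - 2 * κ := le_trans (by positivity) hm2
        have := mul_le_mul_of_nonneg_right hσ1 hY0
        nlinarith [pow_pos hσ 3]
      · have b1 : (2 * Real.pi / 3 * σ - 1) * (2 * Y) ≤ (2 * Real.pi / 3 * σ - 1) * (σ ^ 3 * D) :=
          mul_le_mul_of_nonneg_left hYle (by linarith)
        have b2 : (2 * Real.pi / 3 * σ - 1) * D ≤ 2 * (D - 2 * κ) := by nlinarith
        have b3 := mul_le_mul_of_nonneg_left b2 (pow_pos hσ 3).le
        nlinarith
    linarith
  have hX1 : 2 * √2 * Real.pi / 9 * X ≤ X := mul_le_of_le_one_left hX hc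
  have e3 : 2 / 3 * (3 * κ * σ) + 2 * Real.pi / 3 * Y / σ + 2 * √2 * Real.pi / 9 * X / σ ^ 2 =
      (2 * κ * σ ^ 3 + 2 * Real.pi / 3 * σ * Y + 2 * √2 * Real.pi / 9 * X) / σ ^ 2 := by
    field_simp
  rw [e3, div_le_iff₀ (by positivity)]
  calc _ ≤ 3 / 2 * σ ^ 3 * D := by linarith
    _ = _ := by ring

lemma le_rpow_mul_rpow_of_smoothing {w : ℝ≥0∞} {κ p s A X : ℝ} (hκ : κ = √(2 / Real.pi))
    (hp : 0 ≤ p) (hs : 0 ≤ s) (hA : 0 ≤ A) (hX : 0 ≤ X) (h1 : w ≤ ENNReal.ofReal (p + s))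
    (h2 : ∀ τ : ℝ, 0 < τ →
      w ≤ ENNReal.ofReal (2 / 3 * τ + A / τ + 4 * √2 * X / τ ^ 2)) :
    w ≤ ENNReal.ofReal ((2 : ℝ) ^ (1 / 3 : ℝ) + (2 : ℝ) ^ (-(2 / 3) : ℝ)) *
      ENNReal.ofReal (κ * (2 + s) + p) ^ (2 / 3 : ℝ) *
      ENNReal.ofReal (1 / 4 * κ * A + X) ^ (1 / 3 : ℝ) := by
  have hκ0 : 0 < κ := by rw [hκ]; have := Real.pi_pos; positivity
  set D₁ := κ * (2 + s) + p with hD₁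
  set D₂ := 1 / 4 * κ * A + X with hD₂
  have hD₁0 : 0 < D₁ := by positivity
  have hD₂0 : 0 ≤ D₂ := by positivity
  rcases hD₂0.eq_or_lt with h0 | h0
  -- In the degenerate case only the term `2τ/3` survives, and `τ` tends to `0`.
  · have hA0 : A = 0 := by
      have : 1 / 4 * κ * A = 0 := le_antisymm (by linarith) (by positivity)
      simpa [hκ0.ne'] using this
    have hX0 : X = 0 := by rw [hA0] at hD₂; linarith
    have hw : w ≤ 0 := by
      refine ENNReal.le_of_forall_pos_le_add fun ε hε _ => ?_
      refine (h2 ε hε).trans ?_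
      rw [hA0, hX0, zero_add]
      simp only [zero_div, add_zero, mul_zero]
      calc ENNReal.ofReal (2 / 3 * (ε : ℝ)) ≤ ENNReal.ofReal (ε : ℝ) :=
            ENNReal.ofReal_le_ofReal (by have : (0 : ℝ) < ε := hε; linarith)
        _ = ε := ENNReal.ofReal_coe_nnreal
    exact hw.trans zero_le
  -- With this `σ` the target is exactly `(3/2) σ D₁`, as `2^{1/3} + 2^{-2/3} = (3/2) 2^{1/3}`.
  · set σ : ℝ := (2 * D₂ / D₁) ^ (1 / 3 : ℝ) with hσ
    have hσ0 : 0 < σ := by positivity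
    have hσ3 : σ ^ 3 = 2 * D₂ / D₁ := by
      rw [hσ, ← Real.rpow_natCast, ← Real.rpow_mul (by positivity)]
      norm_num
    have hrel : 2 * D₂ = σ ^ 3 * D₁ := by rw [hσ3]; field_simp
    have hw : w ≤ ENNReal.ofReal (3 / 2 * σ * D₁) := by
      rcases le_or_gt (p + s) (3 / 2 * σ * D₁) with hle | hlt
      · exact h1.trans (ENNReal.ofReal_le_ofReal hle)
      · exact (h2 (3 * κ * σ) (by positivity)).trans
          (ENNReal.ofReal_le_ofReal (smoothing_bound_le hκ hp hs hA hX hσ0 hrel hlt))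
    rw [ENNReal.ofReal_rpow_of_pos hD₁0, ENNReal.ofReal_rpow_of_pos h0,
      ← ENNReal.ofReal_mul (by positivity), ← ENNReal.ofReal_mul (by positivity)]
    refine hw.trans_eq (congrArg _ ?_)
    have hc : (2 : ℝ) ^ (1 / 3 : ℝ) + (2 : ℝ) ^ (-(2 / 3) : ℝ) = 3 / 2 * 2 ^ (1 / 3 : ℝ) := by
      have : (2 : ℝ) ^ (-(2 / 3) : ℝ) = 2 ^ (1 / 3 : ℝ) / 2 := by
        rw [show (-(2 / 3) : ℝ) = 1 / 3 - 1 by norm_num, Real.rpow_sub_one two_ne_zero]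
      rw [this]; ring
    have hD : D₁ = D₁ ^ (2 / 3 : ℝ) * D₁ ^ (1 / 3 : ℝ) := by
      rw [← Real.rpow_add hD₁0]; norm_num
    rw [hc, hσ, Real.div_rpow (by positivity) hD₁0.le, Real.mul_rpow zero_le_two h0.le]
    have hq : D₁ ^ (1 / 3 : ℝ) ≠ 0 := by positivity
    nth_rewrite 2 [hD]
    field_simp

/-! ### The bound for divergences on the Poisson space -/

section

variable {Ω Z : Type*} [MeasurableSpace Ω] [MeasurableSpace Z] {P : Measure Ω}
  {ν : Measure Z} {η : Ω → Config Z}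

/-- Bounded Lipschitz functions of linear combinations stay in the domain of `D`. -/
lemma InDomD.comp_lipschitz [IsProbabilityMeasure P] [SigmaFinite ν] {F S : Config Z → ℝ}
    (hF : InDomD P ν η F) (hS : InDomD P ν η S) {h : ℝ → ℝ} {K : NNReal} {C : ℝ}
    (hh : LipschitzWith K h) (hb : ∀ x, |h x| ≤ C) (a c : ℝ) :
    InDomD P ν η (fun ξ => h (a * F ξ + c * S ξ)) := by
  have hW : AEStronglyMeasurable (fun ω => a * F (η ω) + c * S (η ω)) P :=
    (hF.memLp.1.const_mul a).add (hS.memLp.1.const_mul c)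
  have hdW : MemLp (fun p : Ω × Z => a * addOp F (η p.1) p.2 + c * addOp S (η p.1) p.2) 2
      (P.prod ν) := (hF.memLp_addOp.const_mul a).add (hS.memLp_addOp.const_mul c)
  have e : (fun p : Ω × Z => addOp (fun ξ => h (a * F ξ + c * S ξ)) (η p.1) p.2) = fun p =>
      h (a * F (η p.1) + c * S (η p.1) +
        (a * addOp F (η p.1) p.2 + c * addOp S (η p.1) p.2)) -
      h (a * F (η p.1) + c * S (η p.1)) := by
    ext p
    simp only [addOp]
    ring_nf
  refine ⟨hh.continuous.measurable.comp ((hF.measurable.const_mul a).add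
    (hS.measurable.const_mul c)), ?_, ?_⟩
  · exact MemLp.of_bound (hh.continuous.comp_aestronglyMeasurable hW) C
      (Filter.Eventually.of_forall fun ω => hb _)
  · rw [e]
    refine hdW.of_le_mul (c := K) ((hh.continuous.comp_aestronglyMeasurable
      (hW.comp_fst.add hdW.1)).sub (hh.continuous.comp_aestronglyMeasurable hW.comp_fst))
      (Filter.Eventually.of_forall fun p => ?_)
    simpa [dist_eq_norm] using hh.dist_le_mul (a * F (η p.1) + c * S (η p.1) +
        (a * addOp F (η p.1) p.2 + c * addOp S (η p.1) p.2)) (a * F (η p.1) + c * S (η p.1))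

/-- `h(aF + cS)` lies in the domain of `D`, and its add-one cost is exactly the increment of `h`
from `aF + cS` to `aF + cS + a DF + c DS`. The divergence identity applied to it is the required
duality. -/
lemma IsDivergence.isDualPair [IsProbabilityMeasure P] [SigmaFinite ν] {F S : Config Z → ℝ}
    {u : Config Z → Z → ℝ} (hF : InDomD P ν η F) (hS : InDomD P ν η S) (hu : InL2Field P ν η u)
    (hFu : IsDivergence P ν η u F)
    (hdF : Integrable (fun p : Ω × Z => |u (η p.1) p.2| * addOp F (η p.1) p.2 ^ 2) (P.prod ν))
    (hdS : Integrable (fun p : Ω × Z => |u (η p.1) p.2| * addOp S (η p.1) p.2 ^ 2) (P.prod ν)) :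
    IsDualPair P ν (fun ω => F (η ω)) (fun ω => S (η ω)) (fun p => addOp F (η p.1) p.2)
      (fun p => addOp S (η p.1) p.2) (fun p => u (η p.1) p.2) where
  memLp_X := hF.memLp
  memLp_S := hS.memLp
  memLp_dX := hF.memLp_addOp
  memLp_dS := hS.memLp_addOp
  memLp_U := hu.memLp
  integrable_dX := hdF
  integrable_dS := hdS
  duality := fun h K C hh hb a c => by
    have hG := hF.comp_lipschitz hS hh hb a c
    have hi : Integrable (fun p : Ω × Z => u (η p.1) p.2 *
        addOp (fun ξ => h (a * F ξ + c * S ξ)) (η p.1) p.2) (P.prod ν) :=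
      hu.memLp.integrable_mul hG.memLp_addOp
    have key := hFu.duality _ hG
    rw [← integral_prod _ hi] at key
    rw [key]
    congr 1
    ext p
    simp only [addOp]
    ring_nf

end

lemma lintegral_enorm_eq_ofReal_integral_abs {α : Type*} [MeasurableSpace α] {μ : Measure α}
    {g : α → ℝ} (hg : Integrable g μ) : ∫⁻ x, ‖g x‖ₑ ∂μ = ENNReal.ofReal (∫ x, |g x| ∂μ) := by
  rw [ofReal_integral_eq_lintegral_ofReal hg.abs (Filter.Eventually.of_forall fun _ => abs_nonneg _)]
  simp only [Real.enorm_eq_ofReal_abs]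

theorem mainTheorem4 {Ω Z : Type*} [MeasurableSpace Ω] [MeasurableSpace Z]
    (P : Measure Ω) [IsProbabilityMeasure P] (ν : Measure Z) [SigmaFinite ν]
    (η : Ω → Config Z) (hη : IsPoissonProcess P ν η)
    (F S : Config Z → ℝ) (u : Config Z → Z → ℝ)
    (hF : InDomD P ν η F) (hu : InDomDelta P ν η u) (hFu : IsDivergence P ν η u F)
    (hS : InCov P ν η S) :
    mongeKantorovich (P.map (fun ω => F (η ω))) (gaussianMixture P (fun ω => S (η ω))) ≤
      max
        (ENNReal.ofReal ((2 : ℝ) ^ (1 / 3 : ℝ) + (2 : ℝ) ^ (-(2 / 3) : ℝ)) *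
          delta1 P η F S ^ (2 / 3 : ℝ) * delta2 P ν η u F S ^ (1 / 3 : ℝ))
        (delta1 P η F S * delta2 P ν η u F S) := by
  refine le_max_of_le_left ?_
  have hπ := Real.pi_pos
  have hS1 := hS.1
  have hU := hu.inL2.memLp
  have hκ : 0 < √(2 / Real.pi) := by positivity
  have iF : Integrable (fun ω => F (η ω)) P := hF.memLp.integrable one_le_two
  have iS : Integrable (fun ω => S (η ω)) P := hS1.memLp.integrable one_le_two
  have e1 : delta1 P η F S = ENNReal.ofReal (√(2 / Real.pi) * (2 + ∫ ω, |S (η ω)| ∂P) +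
      ∫ ω, |F (η ω)| ∂P) := by
    have hs : 0 ≤ ∫ ω, |S (η ω)| ∂P := integral_nonneg fun _ => abs_nonneg _
    have hf : 0 ≤ ∫ ω, |F (η ω)| ∂P := integral_nonneg fun _ => abs_nonneg _
    rw [delta1, lintegral_enorm_eq_ofReal_integral_abs iF, lintegral_enorm_eq_ofReal_integral_abs iS,
      ENNReal.ofReal_add (by positivity) hf, ENNReal.ofReal_mul hκ.le,
      ENNReal.ofReal_add zero_le_two hs, ENNReal.ofReal_ofNat]
  -- `Δ₁` is positive, so an infinite `Δ₂` makes the right-hand side infinite. Otherwise finiteness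
  -- of `Δ₂` supplies the integrability that the interpolation needs.
  by_cases htop : delta2 P ν η u F S = ∞
  · have hne : delta1 P η F S ≠ 0 := by
      rw [e1]
      exact (ENNReal.ofReal_pos.2 (by positivity)).ne'
    have hne' : delta1 P η F S ^ (2 / 3 : ℝ) ≠ 0 := by
      rw [Ne, ENNReal.rpow_eq_zero_iff_of_pos (by norm_num)]
      exact hne
    rw [htop, ENNReal.top_rpow_of_pos (by norm_num), ENNReal.mul_top]
    · exact le_top
    · exact mul_ne_zero (ENNReal.ofReal_pos.2 (by positivity)).ne' hne'
  have iUF : Integrable (fun p : Ω × Z => u (η p.1) p.2 * addOp F (η p.1) p.2) (P.prod ν) :=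
    hU.integrable_mul hF.memLp_addOp
  have iUS : Integrable (fun p : Ω × Z => u (η p.1) p.2 * addOp S (η p.1) p.2) (P.prod ν) :=
    hU.integrable_mul hS1.memLp_addOp
  have iA : Integrable (fun ω => (∫ z, u (η ω) z * addOp F (η ω) z ∂ν) - S (η ω) ^ 2) P :=
    iUF.integral_prod_left.sub hS1.memLp.integrable_sq
  have hBtop : ∫⁻ ω, ‖S (η ω) * ∫ z, u (η ω) z * addOp S (η ω) z ∂ν‖ₑ ∂P ≠ ∞ := by
    intro h
    refine htop ?_
    rw [delta2, h, ENNReal.mul_top (ENNReal.ofReal_pos.2 (by norm_num)).ne', top_add,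
      ENNReal.mul_top (ENNReal.ofReal_pos.2 (by positivity)).ne', add_top]
  have hCtop : ∫⁻ ω, ∫⁻ z, ‖u (η ω) z‖ₑ * (‖addOp F (η ω) z‖ₑ ^ 2 + ‖addOp S (η ω) z‖ₑ ^ 2)
      ∂ν ∂P ≠ ∞ := by
    intro h
    refine htop ?_
    rw [delta2, h, ENNReal.mul_top (ENNReal.ofReal_pos.2 (by norm_num)).ne', add_top,
      ENNReal.mul_top (ENNReal.ofReal_pos.2 (by positivity)).ne', add_top]
  have iB : Integrable (fun ω => S (η ω) * ∫ z, u (η ω) z * addOp S (η ω) z ∂ν) P :=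
    ⟨hS1.memLp.1.mul iUS.integral_prod_left.1, hBtop.lt_top⟩
  have hCm : AEStronglyMeasurable (fun p : Ω × Z => |u (η p.1) p.2| *
      (addOp F (η p.1) p.2 ^ 2 + addOp S (η p.1) p.2 ^ 2)) (P.prod ν) :=
    hU.1.norm.mul ((hF.memLp_addOp.1.pow 2).add (hS1.memLp_addOp.1.pow 2))
  have hCe : ∀ p : Ω × Z, ‖|u (η p.1) p.2| * (addOp F (η p.1) p.2 ^ 2 +
      addOp S (η p.1) p.2 ^ 2)‖ₑ = ‖u (η p.1) p.2‖ₑ *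
      (‖addOp F (η p.1) p.2‖ₑ ^ 2 + ‖addOp S (η p.1) p.2‖ₑ ^ 2) := fun p => by
    rw [enorm_mul, Real.enorm_abs, Real.enorm_of_nonneg
      (add_nonneg (sq_nonneg (addOp F (η p.1) p.2)) (sq_nonneg (addOp S (η p.1) p.2))),
      ENNReal.ofReal_add (by positivity) (by positivity), ← enorm_pow, ← enorm_pow,
      Real.enorm_of_nonneg (sq_nonneg _), Real.enorm_of_nonneg (sq_nonneg _)]
  have hCl : ∫⁻ ω, ∫⁻ z, ‖u (η ω) z‖ₑ * (‖addOp F (η ω) z‖ₑ ^ 2 + ‖addOp S (η ω) z‖ₑ ^ 2)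
      ∂ν ∂P = ∫⁻ p, ‖|u (η p.1) p.2| * (addOp F (η p.1) p.2 ^ 2 + addOp S (η p.1) p.2 ^ 2)‖ₑ
      ∂(P.prod ν) := by
    rw [lintegral_prod _ hCm.enorm]
    exact lintegral_congr fun ω => lintegral_congr fun z => (hCe (ω, z)).symm
  have iC : Integrable (fun p : Ω × Z => |u (η p.1) p.2| *
      (addOp F (η p.1) p.2 ^ 2 + addOp S (η p.1) p.2 ^ 2)) (P.prod ν) := by
    refine ⟨hCm, lt_top_iff_ne_top.2 ?_⟩
    rwa [hCl] at hCtop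
  have iCF : Integrable (fun p : Ω × Z => |u (η p.1) p.2| * addOp F (η p.1) p.2 ^ 2)
      (P.prod ν) := by
    refine iC.mono' (hU.1.norm.mul (hF.memLp_addOp.1.pow 2))
      (Filter.Eventually.of_forall fun p => ?_)
    rw [Real.norm_of_nonneg (by positivity)]
    exact mul_le_mul_of_nonneg_left (le_add_of_nonneg_right (sq_nonneg _)) (abs_nonneg _)
  have iCS : Integrable (fun p : Ω × Z => |u (η p.1) p.2| * addOp S (η p.1) p.2 ^ 2)
      (P.prod ν) := by
    refine iC.mono' (hU.1.norm.mul (hS1.memLp_addOp.1.pow 2))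
      (Filter.Eventually.of_forall fun p => ?_)
    rw [Real.norm_of_nonneg (by positivity)]
    exact mul_le_mul_of_nonneg_left (le_add_of_nonneg_left (sq_nonneg _)) (abs_nonneg _)
  have hpair := hFu.isDualPair hF hS1 hu.inL2 iCF iCS
  set p := ∫ ω, |F (η ω)| ∂P with hp
  set s := ∫ ω, |S (η ω)| ∂P with hs
  set A := ∫ ω, |(∫ z, u (η ω) z * addOp F (η ω) z ∂ν) - S (η ω) ^ 2| ∂P with hA
  set B := ∫ ω, |S (η ω) * ∫ z, u (η ω) z * addOp S (η ω) z ∂ν| ∂P with hB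
  set CF := ∫ p : Ω × Z, |u (η p.1) p.2| * addOp F (η p.1) p.2 ^ 2 ∂(P.prod ν) with hCF
  set CS := ∫ p : Ω × Z, |u (η p.1) p.2| * addOp S (η p.1) p.2 ^ 2 ∂(P.prod ν) with hCS
  have hp0 : 0 ≤ p := integral_nonneg fun _ => abs_nonneg _
  have hs0 : 0 ≤ s := integral_nonneg fun _ => abs_nonneg _
  have hA0 : 0 ≤ A := integral_nonneg fun _ => abs_nonneg _
  have hB0 : 0 ≤ B := integral_nonneg fun _ => abs_nonneg _
  have hCF0 : 0 ≤ CF := integral_nonneg fun _ => by positivity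
  have hCS0 : 0 ≤ CS := integral_nonneg fun _ => by positivity
  have hC : ∫ p : Ω × Z, |(|u (η p.1) p.2| *
      (addOp F (η p.1) p.2 ^ 2 + addOp S (η p.1) p.2 ^ 2))| ∂(P.prod ν) = CF + CS := by
    rw [hCF, hCS, ← integral_add iCF iCS]
    congr 1
    ext p
    rw [abs_of_nonneg (by positivity), mul_add]
  have e2 : delta2 P ν η u F S = ENNReal.ofReal (1 / 4 * √(2 / Real.pi) * A +
      √2 * (1 / 3 * B + 1 / 6 * (CF + CS))) := by
    rw [delta2, hCl, lintegral_enorm_eq_ofReal_integral_abs iA,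
      lintegral_enorm_eq_ofReal_integral_abs iB, lintegral_enorm_eq_ofReal_integral_abs iC, hC,
      ENNReal.ofReal_add (p := 1 / 4 * √(2 / Real.pi) * A) (by positivity) (by positivity),
      ENNReal.ofReal_mul (p := 1 / 4 * √(2 / Real.pi)) (by positivity),
      ENNReal.ofReal_mul (p := √2) (by positivity),
      ENNReal.ofReal_add (p := 1 / 3 * B) (by positivity) (by positivity),
      ENNReal.ofReal_mul (p := 1 / 3) (by positivity),
      ENNReal.ofReal_mul (p := 1 / 6) (by positivity)]
  rw [e1, e2]
  refine le_rpow_mul_rpow_of_smoothing rfl hp0 hs0 hA0 (by positivity)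
    hpair.mongeKantorovich_le_moments fun τ hτ => ?_
  refine (hpair.mongeKantorovich_le_smoothing iB hτ).trans (ENNReal.ofReal_le_ofReal ?_)
  have h2 : √2 * √2 = 2 := Real.mul_self_sqrt zero_le_two
  have e : 4 * √2 * (√2 * (1 / 3 * B + 1 / 6 * (CF + CS))) / τ ^ 2 =
      4 / τ ^ 2 * (2 / 3 * B + 1 / 3 * CF + 1 / 3 * CS) := by
    linear_combination (4 * (1 / 3 * B + 1 / 6 * (CF + CS)) / τ ^ 2) * h2
  rw [e]
  -- The interpolation gives `1/6` for the `DF` term; it is relaxed to `1/3` to match the symmetric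
  -- form of `Δ₂`.
  have : 4 / τ ^ 2 * (2 / 3 * B + 1 / 6 * CF + 1 / 3 * CS) ≤
      4 / τ ^ 2 * (2 / 3 * B + 1 / 3 * CF + 1 / 3 * CS) :=
    mul_le_mul_of_nonneg_left (by linarith) (by positivity)
  linarith
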